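/- Let $d\in\mathbf N$, $s>1$ and $q\in[1,\infty]$. **Weights.** Let $\omega:\mathbf R^d\to[0,\infty)$ be a weight in $\mathscr M_{\{s\}}(\mathbf R^d)$, i.e. there are a function $v:\mathbf R^d\to[0,\infty)$ and constants $c,C,k>0$ such that, for all $x,y\in\mathbf R^d$, $v(x+y)\le v(x)v(y)$, $v(x)\le Ce^{k|x|^{1/s}}$ and $\omega(x+y)\le c\,v(x)\omega(y)$. **Ultradistributions.** For $A>0$ and compact $K\subset\mathbf R^d$ let $\mathcal E^s_{A,K}$ be the space of all $\varphi\in C^\infty(\mathbf R^d)$ (complex valued) with $$\|\varphi\|_{s,A,K}=\sup_{\beta\in\mathbf N^d}\ \sup_{x\in K}\frac{A^{|\beta|}}{\beta!^s}|\varphi^{(\beta)}(x)|<\infty ,$$ and let $\mathcal E^{\{s\}}(\mathbf R^d)$ be the projective limit over compact sets $K$ of the locally convex inductive limits of $\mathcal E^s_{A,K}$ as $A\to0$. Let $f\in(\mathcal E^{\{s\}})'(\mathbf R^d)$, i.e. $f$ is a continuous linear functional on $\mathcal E^{\{s\}}(\mathbf R^d)$. Its Fourier transform is the function $\widehat f(\xi)=(2\pi)^{-d/2}\langle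 f,e^{-i\langle\cdot,\xi\rangle}\rangle$, $\xi\in\mathbf R^d$. **Semi-norms.** Write $\mathcal B=\mathscr FL^q_{(\omega)}(\mathbf R^d)$. For an open cone $\Gamma\subseteq\mathbf R^d\setminus0$ and a discrete set $H\subset\mathbf R^d$ put $$|f|_{\mathcal B(\Gamma)}=\Big(\int_\Gamma|\widehat f(\xi)\omega(\xi)|^q\,d\xi\Big)^{1/q},\qquad |f|^{(D)}_{\mathcal B(H)}=\Big(\sum_{\xi\in H}|\widehat f(\xi)\omega(\xi)|^q\Big)^{1/q}$$ (with the essential supremum over $\Gamma$, respectively the supremum over $H$, when $q=\infty$). Both may be $+\infty$. **Statement.** Let $\Gamma$ and $\Gamma_0$ be open cones in $\mathbf R^d\setminus0$ such that the closure of $\Gamma_0$ in $\mathbf R^d\setminus0$ is contained in $\Gamma$, and let $\Lambda=\{a_1e_1+\cdots+a_de_d;\ a_1,\dots,a_d\in\mathbf Z\}$, where $e_1,\dots,e_d$ is a basis of $\mathbf R^d$. If $|f|_{\mathcal B(\Gamma)}<\infty$, then $|f|^{(D)}_{\mathcal B(\Gamma_0\cap\Lambda)}<\infty$. -/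

import Mathlib

open scoped ENNReal

noncomputable section

namespace Ultra

/-- `ℝ^d` with its Euclidean norm. -/
abbrev Rd (d : ℕ) : Type := EuclideanSpace ℝ (Fin d)

/-! ### Weights -/

/-- `v (x + y) ≤ v x * v y`. -/
def IsSubmultiplicative {d : ℕ} (v : Rd d → ℝ) : Prop :=
  ∀ x y, v (x + y) ≤ v x * v y

/-- `ω (x + y) ≲ v x * ω y`. -/
def IsModerate {d : ℕ} (v ω : Rd d → ℝ) : Prop :=
  ∃ c : ℝ, 0 < c ∧ ∀ x y, ω (x + y) ≤ c * (v x * ω y)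

/-- The class of non-negative functions which are moderate with respect to some submultiplicative
weight `v` with `v ≤ C * exp (k * |x| ^ (1 / s))`. -/
def IsRoumieuWeight {d : ℕ} (s : ℝ) (ω : Rd d → ℝ) : Prop :=
  (∀ x, 0 ≤ ω x) ∧
    ∃ v : Rd d → ℝ, (∀ x, 0 ≤ v x) ∧ IsSubmultiplicative v ∧
      (∃ C k : ℝ, 0 < C ∧ 0 < k ∧ ∀ x, v x ≤ C * Real.exp (k * ‖x‖ ^ (1 / s))) ∧
      IsModerate v ω

/-! ### Cones and lattices -/

/-- Open cones in `ℝ^d \ {0}` (not necessarily convex). -/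
def IsOpenCone {d : ℕ} (Γ : Set (Rd d)) : Prop :=
  IsOpen Γ ∧ (0 : Rd d) ∉ Γ ∧ ∀ x ∈ Γ, ∀ t : ℝ, 0 < t → t • x ∈ Γ

/-- Lattices: all integer combinations of a basis of `ℝ^d`. -/
def IsLattice {d : ℕ} (Λ : Set (Rd d)) : Prop :=
  ∃ e : Module.Basis (Fin d) ℝ (Rd d), Λ = {x | ∃ a : Fin d → ℤ, x = ∑ i, (a i : ℝ) • e i}

/-! ### Partial derivatives -/

/-- The `i`-th partial derivative. -/
def pderiv {d : ℕ} (i : Fin d) (φ : Rd d → ℂ) : Rd d → ℂ :=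
  fun x => fderiv ℝ φ x (EuclideanSpace.single i 1)

/-- Successive partial derivatives: `β i` times in the variable `x_i`, for the `i` in a list. -/
def listDeriv {d : ℕ} (β : Fin d → ℕ) (l : List (Fin d)) (φ : Rd d → ℂ) : Rd d → ℂ :=
  l.foldr (fun i ψ => (pderiv i)^[β i] ψ) φ

/-- The derivative `φ^(β)` for a multi-index `β`. -/
def multiDeriv {d : ℕ} (β : Fin d → ℕ) (φ : Rd d → ℂ) : Rd d → ℂ :=
  listDeriv β (List.finRange d) φ

theorem contDiff_pderiv {d : ℕ} (i : Fin d) {φ : Rd d → ℂ} (h : ContDiff ℝ (⊤ : ℕ∞) φ) :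
    ContDiff ℝ (⊤ : ℕ∞) (pderiv i φ) := by
  have h1 : ContDiff ℝ (⊤ : ℕ∞) (fderiv ℝ φ) := h.fderiv_right (m := (⊤ : ℕ∞)) (by norm_num)
  exact h1.clm_apply contDiff_const

theorem pderiv_add {d : ℕ} (i : Fin d) {φ ψ : Rd d → ℂ} (h : ContDiff ℝ (⊤ : ℕ∞) φ)
    (h' : ContDiff ℝ (⊤ : ℕ∞) ψ) : pderiv i (φ + ψ) = pderiv i φ + pderiv i ψ := by
  funext x
  have e : fderiv ℝ (φ + ψ) x = fderiv ℝ φ x + fderiv ℝ ψ x :=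
    fderiv_add ((h.differentiable (by norm_num)) x) ((h'.differentiable (by norm_num)) x)
  simp [pderiv, e]

theorem pderiv_smul {d : ℕ} (i : Fin d) (c : ℂ) {φ : Rd d → ℂ} (h : ContDiff ℝ (⊤ : ℕ∞) φ) :
    pderiv i (c • φ) = c • pderiv i φ := by
  funext x
  have e : fderiv ℝ (c • φ) x = c • fderiv ℝ φ x :=
    fderiv_const_smul ((h.differentiable (by norm_num)) x) c
  simp [pderiv, e]

theorem contDiff_iterate_pderiv {d : ℕ} (i : Fin d) (n : ℕ) {φ : Rd d → ℂ}
    (h : ContDiff ℝ (⊤ : ℕ∞) φ) : ContDiff ℝ (⊤ : ℕ∞) ((pderiv i)^[n] φ) := by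
  induction n with
  | zero => exact h
  | succ n ih => rw [Function.iterate_succ_apply']; exact contDiff_pderiv i ih

theorem iterate_pderiv_add {d : ℕ} (i : Fin d) (n : ℕ) {φ ψ : Rd d → ℂ} (h : ContDiff ℝ (⊤ : ℕ∞) φ)
    (h' : ContDiff ℝ (⊤ : ℕ∞) ψ) :
    (pderiv i)^[n] (φ + ψ) = (pderiv i)^[n] φ + (pderiv i)^[n] ψ := by
  induction n with
  | zero => rfl
  | succ n ih =>
    simp only [Function.iterate_succ_apply']
    rw [ih, pderiv_add i (contDiff_iterate_pderiv i n h) (contDiff_iterate_pderiv i n h')]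

theorem iterate_pderiv_smul {d : ℕ} (i : Fin d) (n : ℕ) (c : ℂ) {φ : Rd d → ℂ}
    (h : ContDiff ℝ (⊤ : ℕ∞) φ) : (pderiv i)^[n] (c • φ) = c • (pderiv i)^[n] φ := by
  induction n with
  | zero => rfl
  | succ n ih =>
    simp only [Function.iterate_succ_apply']
    rw [ih, pderiv_smul i c (contDiff_iterate_pderiv i n h)]

theorem contDiff_listDeriv {d : ℕ} (β : Fin d → ℕ) (l : List (Fin d)) {φ : Rd d → ℂ}
    (h : ContDiff ℝ (⊤ : ℕ∞) φ) : ContDiff ℝ (⊤ : ℕ∞) (listDeriv β l φ) := by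
  induction l with
  | nil => exact h
  | cons i l ih => exact contDiff_iterate_pderiv i (β i) ih

theorem multiDeriv_add {d : ℕ} (β : Fin d → ℕ) {φ ψ : Rd d → ℂ} (h : ContDiff ℝ (⊤ : ℕ∞) φ)
    (h' : ContDiff ℝ (⊤ : ℕ∞) ψ) : multiDeriv β (φ + ψ) = multiDeriv β φ + multiDeriv β ψ := by
  unfold multiDeriv
  induction List.finRange d with
  | nil => rfl
  | cons i l ih =>
    change (pderiv i)^[β i] (listDeriv β l (φ + ψ)) = _
    rw [ih, iterate_pderiv_add i _ (contDiff_listDeriv β l h) (contDiff_listDeriv β l h')]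
    rfl

theorem multiDeriv_smul {d : ℕ} (β : Fin d → ℕ) (c : ℂ) {φ : Rd d → ℂ} (h : ContDiff ℝ (⊤ : ℕ∞) φ) :
    multiDeriv β (c • φ) = c • multiDeriv β φ := by
  unfold multiDeriv
  induction List.finRange d with
  | nil => rfl
  | cons i l ih =>
    change (pderiv i)^[β i] (listDeriv β l (c • φ)) = _
    rw [ih, iterate_pderiv_smul i _ c (contDiff_listDeriv β l h)]
    rfl

/-! ### The space of Gevrey functions of Roumieu type, and its dual -/

/-- `A ^ |β| / (β!) ^ s * |φ^(β) x|`. -/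
def gevreyTerm {d : ℕ} (s A : ℝ) (β : Fin d → ℕ) (φ : Rd d → ℂ) (x : Rd d) : ℝ :=
  A ^ (∑ i, β i) / ((∏ i, (β i).factorial : ℕ) : ℝ) ^ s * ‖multiDeriv β φ x‖

/-- The norm `‖φ‖_{s,A,K}`, the supremum of `gevreyTerm` over all `β` and all `x ∈ K`,
with the value `∞` allowed. -/
def gevreyNorm {d : ℕ} (s A : ℝ) (K : Set (Rd d)) (φ : Rd d → ℂ) : ℝ≥0∞ :=
  ⨆ β : Fin d → ℕ, ⨆ x ∈ K, ENNReal.ofReal (gevreyTerm s A β φ x)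

theorem gevreyTerm_nonneg {d : ℕ} {s A : ℝ} (hA : 0 < A) (β : Fin d → ℕ) (φ : Rd d → ℂ)
    (x : Rd d) : 0 ≤ gevreyTerm s A β φ x := by
  unfold gevreyTerm; positivity

theorem gevreyNorm_mono {d : ℕ} {s A B : ℝ} (hA : 0 < A) (hAB : A ≤ B) (K : Set (Rd d))
    (φ : Rd d → ℂ) : gevreyNorm s A K φ ≤ gevreyNorm s B K φ := by
  unfold gevreyNorm gevreyTerm
  gcongr

theorem gevreyNorm_add {d : ℕ} {s A : ℝ} (hA : 0 < A) (K : Set (Rd d)) {φ ψ : Rd d → ℂ}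
    (h : ContDiff ℝ (⊤ : ℕ∞) φ) (h' : ContDiff ℝ (⊤ : ℕ∞) ψ) :
    gevreyNorm s A K (φ + ψ) ≤ gevreyNorm s A K φ + gevreyNorm s A K ψ := by
  refine iSup_le fun β => iSup₂_le fun x hx => ?_
  have e : gevreyTerm s A β (φ + ψ) x ≤ gevreyTerm s A β φ x + gevreyTerm s A β ψ x := by
    unfold gevreyTerm
    rw [multiDeriv_add β h h', ← mul_add]
    gcongr
    exact norm_add_le _ _
  refine (ENNReal.ofReal_le_ofReal e).trans ?_
  rw [ENNReal.ofReal_add (gevreyTerm_nonneg hA β φ x) (gevreyTerm_nonneg hA β ψ x)]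
  exact add_le_add (le_iSup_of_le β (le_iSup₂_of_le x hx le_rfl))
    (le_iSup_of_le β (le_iSup₂_of_le x hx le_rfl))

theorem gevreyNorm_smul {d : ℕ} {s A : ℝ} (K : Set (Rd d)) (c : ℂ)
    {φ : Rd d → ℂ} (h : ContDiff ℝ (⊤ : ℕ∞) φ) :
    gevreyNorm s A K (c • φ) ≤ ENNReal.ofReal ‖c‖ * gevreyNorm s A K φ := by
  refine iSup_le fun β => iSup₂_le fun x hx => ?_
  have e : gevreyTerm s A β (c • φ) x = ‖c‖ * gevreyTerm s A β φ x := by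
    unfold gevreyTerm
    rw [multiDeriv_smul β c h, Pi.smul_apply, norm_smul]
    ring
  rw [e, ENNReal.ofReal_mul (norm_nonneg c)]
  gcongr
  exact le_iSup_of_le β (le_iSup₂_of_le x hx le_rfl)

/-- The union over `A > 0` of the spaces `E^s_{A,K}` of all `φ ∈ C^∞(ℝ^d)` with
`‖φ‖_{s,A,K} < ∞`. -/
def gevreyOn (d : ℕ) (s : ℝ) (K : Set (Rd d)) : Submodule ℂ (Rd d → ℂ) where
  carrier := {φ | ContDiff ℝ (⊤ : ℕ∞) φ ∧ ∃ A : ℝ, 0 < A ∧ gevreyNorm s A K φ < ∞}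
  add_mem' := by
    rintro φ ψ ⟨h, A, hA, hφ⟩ ⟨h', B, hB, hψ⟩
    have hm : 0 < min A B := lt_min hA hB
    exact ⟨h.add h', min A B, hm, (gevreyNorm_add hm K h h').trans_lt
      (ENNReal.add_lt_top.2 ⟨(gevreyNorm_mono hm (min_le_left _ _) K φ).trans_lt hφ,
        (gevreyNorm_mono hm (min_le_right _ _) K ψ).trans_lt hψ⟩)⟩
  zero_mem' := by
    refine ⟨contDiff_const, 1, one_pos, ?_⟩
    have h := gevreyNorm_smul (s := s) (A := 1) K 0 (contDiff_const : ContDiff ℝ (⊤ : ℕ∞) fun _ : Rd d => (0 : ℂ))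
    simp only [zero_smul, norm_zero, ENNReal.ofReal_zero, zero_mul] at h
    exact h.trans_lt ENNReal.zero_lt_top
  smul_mem' := by
    rintro c φ ⟨h, A, hA, hφ⟩
    exact ⟨h.const_smul c, A, hA, (gevreyNorm_smul K c h).trans_lt
      (ENNReal.mul_lt_top ENNReal.ofReal_lt_top hφ)⟩

/-- The underlying vector space of `E^{s}(ℝ^d)`: the functions which belong to `gevreyOn d s K`
for every compact set `K`. -/
def gevreySubmodule (d : ℕ) (s : ℝ) : Submodule ℂ (Rd d → ℂ) :=
  ⨅ K : TopologicalSpace.Compacts (Rd d), gevreyOn d s (K : Set (Rd d))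

/-- The space `E^{s}(ℝ^d)`; its topology is defined below. -/
def GevreySpace (d : ℕ) (s : ℝ) : Type := gevreySubmodule d s

instance (d : ℕ) (s : ℝ) : AddCommGroup (GevreySpace d s) :=
  inferInstanceAs (AddCommGroup (gevreySubmodule d s))

instance (d : ℕ) (s : ℝ) : Module ℂ (GevreySpace d s) :=
  inferInstanceAs (Module ℂ (gevreySubmodule d s))

/-- The linear inclusion of `E^{s}(ℝ^d)` into `gevreyOn d s K`, for compact `K`. -/
def GevreySpace.toOn (d : ℕ) (s : ℝ) (K : TopologicalSpace.Compacts (Rd d)) :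
    GevreySpace d s →ₗ[ℂ] gevreyOn d s (K : Set (Rd d)) :=
  Submodule.inclusion (iInf_le (fun K : TopologicalSpace.Compacts (Rd d) =>
    gevreyOn d s (K : Set (Rd d))) K)

/-- The continuous seminorms of the locally convex inductive limit (as `A → 0`) of the spaces
`E^s_{A,K}`: those seminorms on the union whose restriction to each `E^s_{A,K}`
is continuous, that is, bounded by a multiple of `‖·‖_{s,A,K}`. -/
def IsIndLimSeminorm {d : ℕ} {s : ℝ} {K : Set (Rd d)} (p : Seminorm ℂ (gevreyOn d s K)) : Prop :=
  ∀ A : ℝ, 0 < A → ∃ C : ℝ, 0 ≤ C ∧ ∀ φ : gevreyOn d s K,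
    gevreyNorm s A K (φ : Rd d → ℂ) < ∞ → p φ ≤ C * (gevreyNorm s A K (φ : Rd d → ℂ)).toReal

/-- Pairs of a compact set `K` and a continuous seminorm of the inductive limit over `K`. -/
abbrev GevreySeminormIndex (d : ℕ) (s : ℝ) : Type :=
  Σ K : TopologicalSpace.Compacts (Rd d),
    {p : Seminorm ℂ (gevreyOn d s (K : Set (Rd d))) // IsIndLimSeminorm p}

instance (d : ℕ) (s : ℝ) : Nonempty (GevreySeminormIndex d s) :=
  ⟨⟨⊥, ⟨0, fun _ _ => ⟨0, le_rfl, fun φ _ => by simp⟩⟩⟩⟩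

/-- The pull-backs to `E^{s}(ℝ^d)` of the continuous seminorms of the inductive limits. -/
def gevreySeminorms (d : ℕ) (s : ℝ) : SeminormFamily ℂ (GevreySpace d s) (GevreySeminormIndex d s) :=
  fun i => i.2.1.comp (GevreySpace.toOn d s i.1)

/-- The topology of `E^{s}(ℝ^d)`, the projective limit over compact sets `K` of the inductive
limits over `A → 0` of `E^s_{A,K}`. -/
instance (d : ℕ) (s : ℝ) : TopologicalSpace (GevreySpace d s) :=
  (gevreySeminorms d s).moduleFilterBasis.topology

theorem gevrey_withSeminorms (d : ℕ) (s : ℝ) : WithSeminorms (gevreySeminorms d s) := ⟨rfl⟩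

/-- `(E^{s})'(ℝ^d)`: the compactly supported ultradistributions of Roumieu type. -/
abbrev CompactUltradistribution (d : ℕ) (s : ℝ) : Type := GevreySpace d s →L[ℂ] ℂ

/-! ### The Fourier transform -/

/-- The function `x ↦ exp (-i ⟨x, ξ⟩)`. -/
def wave {d : ℕ} (ξ : Rd d) : Rd d → ℂ :=
  fun x => Complex.exp (-Complex.I * ((inner ℝ x ξ : ℝ) : ℂ))

theorem contDiff_wave {d : ℕ} (ξ : Rd d) : ContDiff ℝ (⊤ : ℕ∞) (wave ξ) := by
  unfold wave
  have h : ContDiff ℝ (⊤ : ℕ∞) fun x : Rd d => ((inner ℝ x ξ : ℝ) : ℂ) :=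
    Complex.ofRealCLM.contDiff.comp (contDiff_id.inner ℝ contDiff_const)
  exact (contDiff_const.mul h).cexp

theorem pderiv_wave {d : ℕ} (ξ : Rd d) (i : Fin d) :
    pderiv i (wave ξ) = (-Complex.I * (ξ i : ℂ)) • wave ξ := by
  funext x
  have h1 : HasFDerivAt (fun x : Rd d => (inner ℝ x ξ : ℝ)) (innerSL ℝ ξ) x := by
    have := (innerSL ℝ ξ).hasFDerivAt (x := x)
    refine this.congr_of_eventuallyEq (Filter.Eventually.of_forall fun y => ?_)
    simp [real_inner_comm]
  have h2 := Complex.ofRealCLM.hasFDerivAt.comp x h1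
  have h3 := (h2.const_mul (-Complex.I)).cexp
  have h4 : fderiv ℝ (wave ξ) x = _ := h3.fderiv
  simp only [pderiv, h4]
  simp [wave, mul_comm, EuclideanSpace.inner_single_right]

theorem iterate_pderiv_wave {d : ℕ} (ξ : Rd d) (i : Fin d) (n : ℕ) :
    (pderiv i)^[n] (wave ξ) = (-Complex.I * (ξ i : ℂ)) ^ n • wave ξ := by
  induction n with
  | zero => simp
  | succ n ih =>
    rw [Function.iterate_succ_apply', ih, pderiv_smul i _ (contDiff_wave ξ), pderiv_wave,
      smul_smul, pow_succ]

theorem multiDeriv_wave {d : ℕ} (ξ : Rd d) (β : Fin d → ℕ) :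
    multiDeriv β (wave ξ) = (∏ i, (-Complex.I * (ξ i : ℂ)) ^ β i) • wave ξ := by
  have key : ∀ l : List (Fin d), listDeriv β l (wave ξ) =
      (l.map fun i => (-Complex.I * (ξ i : ℂ)) ^ β i).prod • wave ξ := by
    intro l
    induction l with
    | nil => simp [listDeriv]
    | cons i l ih =>
      change (pderiv i)^[β i] (listDeriv β l (wave ξ)) = _
      rw [ih, iterate_pderiv_smul i _ _ (contDiff_wave ξ), iterate_pderiv_wave, smul_smul,
        List.map_cons, List.prod_cons, mul_comm]
  rw [multiDeriv, key, ← List.ofFn_eq_map, List.prod_ofFn]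

theorem wave_mem {d : ℕ} {s : ℝ} (hs : 1 < s) (ξ : Rd d) : wave ξ ∈ gevreySubmodule d s := by
  refine (Submodule.mem_iInf _).2 fun K => ⟨contDiff_wave ξ, (1 + ‖ξ‖)⁻¹, by positivity, ?_⟩
  refine lt_of_le_of_lt (iSup_le fun β => iSup₂_le fun x _ => ?_) ENNReal.one_lt_top
  rw [← ENNReal.ofReal_one]
  refine ENNReal.ofReal_le_ofReal ?_
  have hw : ‖wave ξ x‖ = 1 := by
    have := Complex.norm_exp_ofReal_mul_I (-(inner ℝ x ξ))
    rw [← this, wave]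
    congr 2
    push_cast
    ring
  have hp : ‖multiDeriv β (wave ξ) x‖ ≤ (1 + ‖ξ‖) ^ (∑ i, β i) := by
    rw [multiDeriv_wave, Pi.smul_apply, norm_smul, hw, mul_one, norm_prod,
      ← Finset.prod_pow_eq_pow_sum]
    refine Finset.prod_le_prod (fun _ _ => norm_nonneg _) fun i _ => ?_
    rw [norm_pow, norm_mul, norm_neg, Complex.norm_I, one_mul, Complex.norm_real]
    gcongr
    exact (PiLp.norm_apply_le ξ i).trans (by linarith)
  have hf : (1 : ℝ) ≤ ((∏ i, (β i).factorial : ℕ) : ℝ) ^ s := by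
    refine Real.one_le_rpow ?_ (by linarith)
    exact_mod_cast Finset.prod_pos fun i _ => (β i).factorial_pos
  unfold gevreyTerm
  calc (1 + ‖ξ‖)⁻¹ ^ (∑ i, β i) / ((∏ i, (β i).factorial : ℕ) : ℝ) ^ s * ‖multiDeriv β (wave ξ) x‖
      ≤ (1 + ‖ξ‖)⁻¹ ^ (∑ i, β i) * (1 + ‖ξ‖) ^ (∑ i, β i) := by
        gcongr
        exact div_le_self (by positivity) hf
    _ = 1 := by rw [← mul_pow, inv_mul_cancel₀ (by positivity), one_pow]

/-- The function `x ↦ exp (-i ⟨x, ξ⟩)` as an element of `E^{s}(ℝ^d)`. -/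
def waveGevrey {d : ℕ} {s : ℝ} (hs : 1 < s) (ξ : Rd d) : GevreySpace d s := ⟨wave ξ, wave_mem hs ξ⟩

/-- The Fourier transform of a compactly supported ultradistribution, the function
`ξ ↦ (2π)^(-d/2) ⟨f, exp (-i ⟨·, ξ⟩)⟩`. -/
def fourier {d : ℕ} {s : ℝ} (hs : 1 < s) (f : CompactUltradistribution d s) (ξ : Rd d) : ℂ :=
  (((2 * Real.pi) ^ (-(d : ℝ) / 2) : ℝ) : ℂ) * f (waveGevrey hs ξ)

/-! ### Continuous and discrete semi-norms -/

/-- The semi-norm `|f|_{B(Γ)}` for `B = FL^q_(ω)`: the `L^q(Γ)` norm of `f^ ω`. -/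
def contSeminorm {d : ℕ} {s : ℝ} (hs : 1 < s) (q : ℝ≥0∞) (ω : Rd d → ℝ) (Γ : Set (Rd d))
    (f : CompactUltradistribution d s) : ℝ≥0∞ :=
  MeasureTheory.eLpNorm (fun ξ => fourier hs f ξ * (ω ξ : ℂ)) q
    (MeasureTheory.volume.restrict Γ)

open Classical in
/-- The discrete semi-norm `|f|^(D)_{B(H)}` for `B = FL^q_(ω)`. -/
def discSeminorm {d : ℕ} {s : ℝ} (hs : 1 < s) (q : ℝ≥0∞) (ω : Rd d → ℝ) (H : Set (Rd d))
    (f : CompactUltradistribution d s) : ℝ≥0∞ :=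
  if q = ∞ then ⨆ ξ ∈ H, ‖fourier hs f ξ * (ω ξ : ℂ)‖ₑ
  else (∑' ξ : H, ‖fourier hs f ξ * (ω ξ : ℂ)‖ₑ ^ q.toReal) ^ (1 / q.toReal)

end Ultra

end

/-! Continuity of f bounds |⟨f, φ⟩| by Gevrey bounds of φ on a ball only. So any rapidly convergent
series of plane waves that sums to 1 on a slightly larger ball yields a reproducing formula for f̂.
For h in a box [h₀, 2h₀]^d, with m·h = (m_i h_i), it reads f̂(ξ) = Σ_m c(h, m) f̂(ξ + m·h), the sum
running over ℤ^d (`exists_fourier_series`). The coefficients decay faster than exp(-k Σ |m_i|^(1/s))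
for every k, uniformly in h, and vanish as soon as some m_i = 0.

The decay handles the cones. For ξ in Γ₀, either |m·h| ≤ c|ξ|, so that ξ + m·h lies in Γ and ω(ξ) is
exchanged for ω(ξ + m·h) at the price exp(k|m·h|^(1/s)); or |ξ| ≲ |m|, and the growth
exp(C|·|^(1/s)) of f̂ and ω is paid for by c(h, m) (`exists_enorm_fourier_mul_le`).

The vanishing turns sums into integrals. When no m_i is zero, h ↦ m·h has determinant of modulus at
least 1, so the average of a function of ξ + m·h over the box is controlled by its integral over a
ball about ξ of radius O(|m|). Summation over lattice points ξ then costs the number of them in such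
a ball, again absorbed by the decay (`tsum_lintegral_box_le`). For q = ∞ a single good h suffices.

The coefficients are products of one-dimensional ones. Those come from an absolutely convergent
series without constant term that is 1 on an interval, averaged over infinitely many windows of
widths ~ j^(-σ) with 1 < σ < s; this multiplies the coefficients by ∏ sinc. -/

open Filter Topology MeasureTheory

/-! ### Exponential series that are one on an interval -/

/-- This linear control near zero makes the product of the `sinc (a j * y)` converge once the `|a
j|` are summable. -/
theorem abs_sinc_sub_one_le (t : ℝ) : |Real.sinc t - 1| ≤ 2 * |t| := by
  wlog ht : 0 ≤ t generalizing t
  · have := this (-t) (by linarith)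
    rwa [Real.sinc_neg, abs_neg] at this
  rcases ht.eq_or_lt with rfl | h0
  · simp
  rw [abs_of_pos h0, abs_le]
  have h1 := Real.sinc_le_one t
  refine ⟨?_, by linarith⟩
  rcases le_total t 1 with h | h
  · have h2 := Real.sin_gt_sub_cube h0
    have h3 : 1 - t ^ 2 / 6 ≤ Real.sinc t := by
      rw [Real.sinc_of_ne_zero h0.ne', le_div_iff₀ h0]
      nlinarith
    nlinarith
  · linarith [Real.neg_one_le_sinc t]

theorem abs_sinc_le_inv_abs {t : ℝ} (ht : t ≠ 0) : |Real.sinc t| ≤ |t|⁻¹ := by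
  rw [Real.sinc_of_ne_zero ht, abs_div, div_eq_mul_inv]
  exact mul_le_of_le_one_left (by positivity) (Real.abs_sin_le_one t)

theorem integral_exp_mul_I_symm {a : ℝ} (y : ℝ) :
    ∫ u in -a..a, Complex.exp ((y * u : ℝ) * Complex.I) = 2 * a * Real.sinc (a * y) := by
  rcases eq_or_ne y 0 with rfl | hy
  · simp; ring
  have h := intervalIntegral.integral_comp_mul_left (a := -a) (b := a)
    (fun t : ℝ => Complex.exp (t * Complex.I)) hy
  rw [h, mul_neg, integral_exp_mul_I_eq_sinc, mul_comm a y]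
  rw [Complex.real_smul]
  have : (y : ℂ) ≠ 0 := by exact_mod_cast hy
  push_cast
  field_simp

theorem norm_exp_ofReal_mul_I_eq_one (t : ℝ) : ‖Complex.exp ((t : ℂ) * Complex.I)‖ = 1 :=
  Complex.norm_exp_ofReal_mul_I t

/-- Averaging over `[-a, a]` an exponential series that is one on `[-ρ, ρ]` multiplies the
coefficients by values of `sinc`. -/
theorem hasSum_mul_sinc {ι : Type*} [Countable ι] {c : ι → ℂ} {lam : ι → ℝ} {ρ a : ℝ}
    (hc : Summable fun i => ‖c i‖)
    (h : ∀ x : ℝ, |x| ≤ ρ → HasSum (fun i => c i * Complex.exp ((lam i * x : ℝ) * Complex.I)) 1)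
    (ha : 0 < a) {x : ℝ} (hx : |x| ≤ ρ - a) :
    HasSum (fun i => c i * Real.sinc (a * lam i) * Complex.exp ((lam i * x : ℝ) * Complex.I)) 1 := by
  -- Integrate the identity at `x + u` over |u| ≤ a; these points stay in [-ρ, ρ].
  have key := intervalIntegral.hasSum_integral_of_dominated_convergence
    (μ := MeasureTheory.volume) (a := -a) (b := a)
    (F := fun i u => c i * Complex.exp ((lam i * (x + u) : ℝ) * Complex.I))
    (f := fun _ => (1 : ℂ)) (fun i _ => ‖c i‖)
    (fun i => (by fun_prop : Continuous _).aestronglyMeasurable)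
    (fun i => Eventually.of_forall fun u _ => by
      rw [norm_mul, norm_exp_ofReal_mul_I_eq_one, mul_one])
    (Eventually.of_forall fun u _ => hc) (by simp)
    (Eventually.of_forall fun u hu => h (x + u) ?_)
  · have h2 := key.mul_left ((2 * a : ℂ)⁻¹)
    have ha' : (a : ℂ) ≠ 0 := by exact_mod_cast ha.ne'
    convert! h2 using 1
    · funext i
      have e : ∀ u : ℝ, c i * Complex.exp ((lam i * (x + u) : ℝ) * Complex.I) =
          (c i * Complex.exp ((lam i * x : ℝ) * Complex.I)) *
            Complex.exp ((lam i * u : ℝ) * Complex.I) := by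
        intro u
        rw [mul_assoc, ← Complex.exp_add]
        congr 2
        push_cast
        ring
      simp_rw [e]
      rw [intervalIntegral.integral_const_mul, integral_exp_mul_I_symm]
      field_simp
    · rw [intervalIntegral.integral_const]
      simp only [sub_neg_eq_add, Complex.real_smul, mul_one]
      push_cast
      field_simp
      ring
  · rw [Set.uIoc_of_le (by linarith)] at hu
    have : |u| ≤ a := abs_le.2 ⟨hu.1.le, hu.2⟩
    exact (abs_add_le _ _).trans (by linarith)

/-- Each average uses up `a j` of the interval on which the sum is one. -/
theorem hasSum_mul_prod_sinc {ι : Type*} [Countable ι] {c : ι → ℂ} {lam : ι → ℝ} {ρ : ℝ}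
    {a : ℕ → ℝ} (ha : ∀ j, 0 < a j) (hc : Summable fun i => ‖c i‖)
    (h : ∀ x : ℝ, |x| ≤ ρ → HasSum (fun i => c i * Complex.exp ((lam i * x : ℝ) * Complex.I)) 1)
    (J : ℕ) : ∀ {x : ℝ}, |x| ≤ ρ - ∑ j ∈ Finset.range J, a j →
    HasSum (fun i => c i * (∏ j ∈ Finset.range J, Real.sinc (a j * lam i) : ℝ) *
      Complex.exp ((lam i * x : ℝ) * Complex.I)) 1 := by
  induction J with
  | zero => intro x hx; simpa using h x (by simpa using hx)
  | succ J ih =>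
    intro x hx
    have hs : Summable fun i => ‖c i * (∏ j ∈ Finset.range J, Real.sinc (a j * lam i) : ℝ)‖ := by
      refine hc.of_nonneg_of_le (fun _ => norm_nonneg _) fun i => ?_
      rw [norm_mul, Complex.norm_real, norm_prod]
      exact mul_le_of_le_one_right (norm_nonneg _)
        (Finset.prod_le_one (fun _ _ => norm_nonneg _) fun _ _ => Real.abs_sinc_le_one _)
    have := hasSum_mul_sinc hs (fun x hx => ih hx) (ha J) (x := x)
      (by rw [Finset.sum_range_succ] at hx; linarith)
    convert! this using 2 with i
    rw [Finset.prod_range_succ]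
    push_cast
    ring

/-- The infinite product of the numbers `sinc (a j * y)`. -/
noncomputable def sincProd (a : ℕ → ℝ) (y : ℝ) : ℝ := ∏' j, Real.sinc (a j * y)

theorem tendsto_sincProd {a : ℕ → ℝ} (hs : Summable fun j => |a j|) (y : ℝ) :
    Tendsto (fun J => ∏ j ∈ Finset.range J, Real.sinc (a j * y)) atTop (𝓝 (sincProd a y)) := by
  have h : Summable fun j => Real.sinc (a j * y) - 1 := by
    refine Summable.of_norm_bounded (hs.mul_left (2 * |y|)) fun j => ?_
    refine (abs_sinc_sub_one_le _).trans_eq ?_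
    rw [abs_mul]; ring
  have := (Real.multipliable_one_add_of_summable h).hasProd.tendsto_prod_nat
  simpa [sincProd] using this

theorem abs_prod_sinc_le_one (a : ℕ → ℝ) (y : ℝ) (J : ℕ) :
    |∏ j ∈ Finset.range J, Real.sinc (a j * y)| ≤ 1 := by
  rw [Finset.abs_prod]
  exact Finset.prod_le_one (fun _ _ => abs_nonneg _) fun _ _ => Real.abs_sinc_le_one _

theorem abs_sincProd_le_one {a : ℕ → ℝ} (hs : Summable fun j => |a j|) (y : ℝ) :
    |sincProd a y| ≤ 1 :=
  le_of_tendsto (tendsto_sincProd hs y).abs (Eventually.of_forall (abs_prod_sinc_le_one a y))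

/-- All factors have modulus at most one, so those beyond the first `N` may be dropped; `N` stays
free. -/
theorem abs_sincProd_le {a : ℕ → ℝ} (ha : ∀ j, 0 < a j) (hs : Summable fun j => |a j|) {y : ℝ}
    (hy : y ≠ 0) (N : ℕ) : |sincProd a y| ≤ ∏ j ∈ Finset.range N, (a j * |y|)⁻¹ := by
  refine le_of_tendsto (tendsto_sincProd hs y).abs ?_
  filter_upwards [eventually_ge_atTop N] with J hJ
  rw [Finset.abs_prod, ← Finset.prod_range_mul_prod_Ico _ hJ]
  refine (mul_le_of_le_one_right (Finset.prod_nonneg fun _ _ => abs_nonneg _)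
    (Finset.prod_le_one (fun _ _ => abs_nonneg _) fun _ _ => Real.abs_sinc_le_one _)).trans ?_
  refine Finset.prod_le_prod (fun _ _ => abs_nonneg _) fun j _ => ?_
  refine (abs_sinc_le_inv_abs (mul_ne_zero (ha j).ne' hy)).trans_eq ?_
  rw [abs_mul, abs_of_pos (ha j)]

theorem hasSum_mul_sincProd {ι : Type*} [Countable ι] {c : ι → ℂ} {lam : ι → ℝ} {ρ r : ℝ}
    {a : ℕ → ℝ} (ha : ∀ j, 0 < a j) (hs : Summable fun j => |a j|)
    (hr : ∀ J, ∑ j ∈ Finset.range J, a j ≤ r) (hc : Summable fun i => ‖c i‖)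
    (h : ∀ x : ℝ, |x| ≤ ρ → HasSum (fun i => c i * Complex.exp ((lam i * x : ℝ) * Complex.I)) 1)
    {x : ℝ} (hx : |x| ≤ ρ - r) :
    HasSum (fun i => c i * sincProd a (lam i) * Complex.exp ((lam i * x : ℝ) * Complex.I)) 1 := by
  have hJ : ∀ J, HasSum (fun i => c i * (∏ j ∈ Finset.range J, Real.sinc (a j * lam i) : ℝ) *
      Complex.exp ((lam i * x : ℝ) * Complex.I)) 1 := fun J =>
    hasSum_mul_prod_sinc ha hc h J (hx.trans (by linarith [hr J]))
  have hsum : Summable fun i => c i * sincProd a (lam i) *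
      Complex.exp ((lam i * x : ℝ) * Complex.I) := by
    refine Summable.of_norm_bounded hc fun i => ?_
    rw [norm_mul, norm_mul, norm_exp_ofReal_mul_I_eq_one, mul_one, Complex.norm_real]
    exact mul_le_of_le_one_right (norm_nonneg _) (abs_sincProd_le_one hs _)
  have ht := tendsto_tsum_of_dominated_convergence (𝓕 := atTop) hc
    (f := fun J i => c i * (∏ j ∈ Finset.range J, Real.sinc (a j * lam i) : ℝ) *
      Complex.exp ((lam i * x : ℝ) * Complex.I))
    (g := fun i => c i * sincProd a (lam i) * Complex.exp ((lam i * x : ℝ) * Complex.I))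
    (fun i => ((Complex.continuous_ofReal.tendsto _).comp
      (tendsto_sincProd hs (lam i))).const_mul _ |>.mul_const _)
    (Eventually.of_forall fun J i => by
      rw [norm_mul, norm_mul, norm_exp_ofReal_mul_I_eq_one, mul_one, Complex.norm_real]
      exact mul_le_of_le_one_right (norm_nonneg _) (abs_prod_sinc_le_one a _ J))
  simp_rw [fun J => (hJ J).tsum_eq] at ht
  rw [tendsto_nhds_unique tendsto_const_nhds ht]
  exact hsum.hasSum

/-- The decay of an infinite product of `sinc` with step widths `α / (j + 1) ^ σ`. -/
theorem abs_sincProd_rpow_le {α σ : ℝ} (hα : 0 < α) (hσ : 1 < σ)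
    (hs : Summable fun j : ℕ => |α * ((j : ℝ) + 1) ^ (-σ)|) {y : ℝ} (hy : y ≠ 0) :
    |sincProd (fun j => α * ((j : ℝ) + 1) ^ (-σ)) y| ≤
      2 ^ σ * Real.exp (-(σ / 2 * (α * |y|) ^ (1 / σ))) := by
  set P := |sincProd (fun j => α * ((j : ℝ) + 1) ^ (-σ)) y| with hP
  have hσ0 : 0 < σ := by linarith
  have hy' : 0 < |y| := abs_pos.2 hy
  set τ := (α * |y|) ^ (1 / σ) with hτ
  have hτ0 : 0 < τ := by positivity
  have hτσ : τ ^ σ = α * |y| := by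
    rw [hτ, ← Real.rpow_mul (by positivity), one_div_mul_cancel hσ0.ne', Real.rpow_one]
  -- The product of (j + 1)^σ / (α|y|) over j < N equals (N! / τ^N)^σ.
  have hN : ∀ N : ℕ, P ≤ ((N.factorial : ℝ) / τ ^ N) ^ σ := by
    intro N
    refine (abs_sincProd_le (fun j => by positivity) hs hy N).trans_eq ?_
    rw [Real.div_rpow (by positivity) (by positivity), ← Real.rpow_natCast τ N, ← Real.rpow_mul hτ0.le,
      mul_comm (N : ℝ) σ, Real.rpow_mul hτ0.le, hτσ, Real.rpow_natCast]
    clear_value τ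
    induction N with
    | zero => simp
    | succ N ih =>
      rw [Finset.prod_range_succ, ih, Nat.factorial_succ, Nat.cast_mul,
        Real.mul_rpow (by positivity) (by positivity), Real.rpow_neg (by positivity)]
      push_cast
      field_simp
      ring
  -- Instead of optimizing over `N`, weight the bound by (τ/2)^N / N! and sum: an exponential on the
  -- left, a geometric series on the right.
  have hN' : ∀ N : ℕ, P ^ (1 / σ) * ((τ / 2) ^ N / N.factorial) ≤ (1 / 2) ^ N := by
    intro N
    have h1 : P ^ (1 / σ) ≤ (N.factorial : ℝ) / τ ^ N := by
      refine (Real.rpow_le_rpow (abs_nonneg _) (hN N) (by positivity)).trans_eq ?_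
      rw [← Real.rpow_mul (by positivity), mul_one_div_cancel hσ0.ne', Real.rpow_one]
    calc P ^ (1 / σ) * ((τ / 2) ^ N / N.factorial)
        ≤ (N.factorial : ℝ) / τ ^ N * ((τ / 2) ^ N / N.factorial) := by gcongr
      _ = (1 / 2) ^ N := by
        have : (N.factorial : ℝ) ≠ 0 := by positivity
        field_simp
        rw [← mul_pow, mul_one_div]
  have hexp : HasSum (fun N : ℕ => (τ / 2) ^ N / N.factorial) (Real.exp (τ / 2)) := by
    rw [Real.exp_eq_exp_ℝ]
    exact NormedSpace.expSeries_div_hasSum_exp (τ / 2)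
  have h2 : P ^ (1 / σ) * Real.exp (τ / 2) ≤ 2 :=
    hasSum_le hN' (hexp.mul_left _) hasSum_geometric_two
  have h3 : P ^ (1 / σ) ≤ 2 * Real.exp (-(τ / 2)) := by
    rw [Real.exp_neg, ← div_eq_mul_inv, le_div_iff₀ (Real.exp_pos _)]
    exact h2
  have h4 := Real.rpow_le_rpow (by positivity) h3 hσ0.le
  rw [← Real.rpow_mul (abs_nonneg _), one_div_mul_cancel hσ0.ne', Real.rpow_one,
    Real.mul_rpow (by norm_num) (Real.exp_pos _).le, ← Real.exp_mul] at h4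
  refine h4.trans_eq ?_
  congr 2
  ring

/-- The two sides without constant cross at `Y`: below it the lower power is bounded, above it the
higher power wins. -/
theorem exists_mul_rpow_le_add {p r k c : ℝ} (hp : 0 < p) (hpr : p < r) (hc : 0 < c) (hk : 0 < k) :
    ∃ C : ℝ, ∀ y : ℝ, 0 ≤ y → k * y ^ p ≤ c * y ^ r + C := by
  set Y := (k / c) ^ (1 / (r - p)) with hY
  have hY0 : 0 < Y := by positivity
  refine ⟨k * Y ^ p, fun y hy => ?_⟩
  rcases le_total y Y with h | h
  · have : k * y ^ p ≤ k * Y ^ p := by gcongr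
    have : 0 ≤ c * y ^ r := by positivity
    linarith
  · have hy0 : 0 < y := hY0.trans_le h
    have h1 : k / c ≤ y ^ (r - p) := by
      have : Y ^ (r - p) ≤ y ^ (r - p) := by
        apply Real.rpow_le_rpow hY0.le h; linarith
      rwa [hY, ← Real.rpow_mul (by positivity), one_div_mul_cancel (by linarith),
        Real.rpow_one] at this
    have h2 : k ≤ c * y ^ (r - p) := by
      rw [div_le_iff₀ hc] at h1; linarith
    have h3 : c * y ^ r = c * y ^ (r - p) * y ^ p := by
      rw [mul_assoc, ← Real.rpow_add hy0]; ring_nf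
    have h4 : k * y ^ p ≤ c * y ^ r := by rw [h3]; gcongr
    have : 0 ≤ k * Y ^ p := by positivity
    linarith

/-- Coefficients of an absolutely convergent Fourier series which is one on `[-1/4, 1/4]`, with
vanishing mean. -/
noncomputable def bernoulliCoeff (n : ℤ) : ℂ :=
  4 / (Real.pi : ℂ) ^ 2 * (1 / (n : ℂ) ^ 2 *
    (Complex.exp (2 * Real.pi * Complex.I * n * (3 / 4)) +
      Complex.exp (2 * Real.pi * Complex.I * n * (1 / 4)) -
      2 * Complex.exp (2 * Real.pi * Complex.I * n * (1 / 2))))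

-- The convention 1 / 0 = 0 agrees here with the zero mean of the Bernoulli polynomial.
@[simp] theorem bernoulliCoeff_zero : bernoulliCoeff 0 = 0 := by simp [bernoulliCoeff]

/-- The series is a second difference, with step 1/4, of the Fourier series of the second Bernoulli
polynomial. Being quadratic and monic, the polynomial has the constant second difference 1/8 while
all three arguments lie in [0, 1], that is for |z| ≤ 1/4; the factor 4/π² normalizes. -/
theorem hasSum_bernoulliCoeff {z : ℝ} (hz : |z| ≤ 1 / 4) :
    HasSum (fun n : ℤ => bernoulliCoeff n * Complex.exp ((2 * Real.pi * n * z : ℝ) * Complex.I))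
      1 := by
  obtain ⟨hz1, hz2⟩ := abs_le.1 hz
  have h1 := hasSum_one_div_pow_mul_fourier_mul_bernoulliFun (k := 2) le_rfl (x := z + 3 / 4)
    ⟨by linarith, by linarith⟩
  have h2 := hasSum_one_div_pow_mul_fourier_mul_bernoulliFun (k := 2) le_rfl (x := z + 1 / 4)
    ⟨by linarith, by linarith⟩
  have h3 := hasSum_one_div_pow_mul_fourier_mul_bernoulliFun (k := 2) le_rfl (x := z + 1 / 2)
    ⟨by linarith, by linarith⟩
  have h := ((h1.add h2).sub (h3.mul_left 2)).mul_left (4 / (Real.pi : ℂ) ^ 2)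
  have hpi : (Real.pi : ℂ) ≠ 0 := by exact_mod_cast Real.pi_ne_zero
  convert! h using 1
  · funext n
    have e : ∀ t : ℝ, fourier n ((z + t : ℝ) : UnitAddCircle) =
        Complex.exp (2 * Real.pi * Complex.I * n * t) *
          Complex.exp ((2 * Real.pi * n * z : ℝ) * Complex.I) := by
      intro t
      rw [fourier_coe_apply, ← Complex.exp_add]
      congr 1
      push_cast
      ring
    rw [e, e, e, bernoulliCoeff]
    push_cast
    ring
  · simp only [bernoulliFun_two]
    push_cast
    have : Complex.I ^ 2 = -1 := Complex.I_sq
    field_simp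
    rw [this]
    norm_num [Nat.factorial]
    ring

theorem norm_bernoulliCoeff_le (n : ℤ) : ‖bernoulliCoeff n‖ ≤ 16 * (1 / (n : ℝ) ^ 2) := by
  have e : ∀ t : ℝ, ‖Complex.exp (2 * Real.pi * Complex.I * n * t)‖ = 1 := by
    intro t
    rw [← norm_exp_ofReal_mul_I_eq_one (2 * Real.pi * n * t)]
    congr 2
    push_cast
    ring
  have h1 := e (3 / 4)
  have h2 := e (1 / 4)
  have h3 := e (1 / 2)
  push_cast at h1 h2 h3
  have hpi : 1 ≤ Real.pi ^ 2 := by nlinarith [Real.pi_gt_three]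
  have h4 : ‖(4 / (Real.pi : ℂ) ^ 2 : ℂ)‖ ≤ 4 := by
    rw [norm_div, norm_pow, Complex.norm_real, Real.norm_eq_abs, sq_abs]
    simpa using div_le_self (by norm_num : (0 : ℝ) ≤ 4) hpi
  rw [bernoulliCoeff, norm_mul, norm_mul]
  have h5 : ‖Complex.exp (2 * Real.pi * Complex.I * n * (3 / 4)) +
      Complex.exp (2 * Real.pi * Complex.I * n * (1 / 4)) -
      2 * Complex.exp (2 * Real.pi * Complex.I * n * (1 / 2))‖ ≤ 4 := by
    refine (norm_sub_le _ _).trans ?_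
    refine (add_le_add (norm_add_le _ _) le_rfl).trans ?_
    rw [h1, h2, norm_mul, h3]
    norm_num
  have h6 : ‖(1 / (n : ℂ) ^ 2 : ℂ)‖ = 1 / (n : ℝ) ^ 2 := by
    rw [norm_div, norm_pow, Complex.norm_intCast, sq_abs, norm_one]
  rw [h6]
  calc _ ≤ 4 * (1 / (n : ℝ) ^ 2 * 4) := by gcongr
    _ = _ := by ring

theorem summable_norm_bernoulliCoeff : Summable fun n => ‖bernoulliCoeff n‖ :=
  ((Real.summable_one_div_int_pow.2 one_lt_two).mul_left 16).of_nonneg_of_le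
    (fun _ => norm_nonneg _) norm_bernoulliCoeff_le

theorem norm_bernoulliCoeff_le_const (n : ℤ) : ‖bernoulliCoeff n‖ ≤ 16 := by
  refine (norm_bernoulliCoeff_le n).trans ?_
  rcases eq_or_ne n 0 with rfl | hn
  · simp
  · have : (1 : ℝ) ≤ (n : ℝ) ^ 2 := by
      rw [← sq_abs]
      have : (1 : ℝ) ≤ |(n : ℝ)| := by exact_mod_cast Int.one_le_abs hn
      nlinarith
    have : 1 / (n : ℝ) ^ 2 ≤ 1 := div_le_one_of_le₀ this (by positivity)
    linarith

/-- For all step widths `h` in an interval `[h₀, 2 h₀]` there is an exponential series with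
frequencies in `h ℤ \ {0}` that is one on `[-R, R]`, whose coefficients decay faster than
any `exp (-k |n| ^ (1 / s))`, uniformly in `h`. -/
theorem exists_exponential_series_eq_one {s : ℝ} (hs : 1 < s) {R : ℝ} (hR : 0 ≤ R) :
    ∃ h₀ : ℝ, 0 < h₀ ∧ ∃ c : ℝ → ℤ → ℂ, (∀ h, c h 0 = 0) ∧
      (∀ k : ℝ, 0 < k → ∃ C : ℝ, 0 < C ∧ ∀ h ∈ Set.Icc h₀ (2 * h₀), ∀ n : ℤ,
        ‖c h n‖ ≤ C * Real.exp (-(k * |(n : ℝ)| ^ (1 / s)))) ∧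
      ∀ h ∈ Set.Icc h₀ (2 * h₀), ∀ x : ℝ, |x| ≤ R →
        HasSum (fun n : ℤ => c h n * Complex.exp ((n * h * x : ℝ) * Complex.I)) 1 := by
  -- σ > 1 makes the widths summable; σ < s makes the decay exp(-c|y|^(1/σ)) beat every
  -- exp(-k|y|^(1/s)).
  obtain ⟨σ, hσ1, hσs⟩ := exists_between hs
  have hσ0 : 0 < σ := by linarith
  have hsum : Summable fun j : ℕ => ((j : ℝ) + 1) ^ (-σ) := by
    have := (summable_nat_add_iff 1).2 (Real.summable_nat_rpow (p := -σ) |>.2 (by linarith))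
    simpa using this
  set S := ∑' j : ℕ, ((j : ℝ) + 1) ^ (-σ) with hS
  have hS0 : 0 < S := hsum.tsum_pos (fun j => by positivity) 0 (by positivity)
  -- The widths add up to one, so averaging shrinks [-(R + 1), R + 1] to [-R, R].
  set α := S⁻¹ with hα
  have hα0 : 0 < α := by positivity
  set a : ℕ → ℝ := fun j => α * ((j : ℝ) + 1) ^ (-σ) with ha
  have ha0 : ∀ j, 0 < a j := fun j => by positivity
  have hasum : Summable fun j => |a j| := by
    simp_rw [fun j => abs_of_pos (ha0 j)]; exact hsum.mul_left α
  have hsum1 : ∀ J, ∑ j ∈ Finset.range J, a j ≤ 1 := by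
    intro J
    have := (hsum.mul_left α).sum_le_tsum (Finset.range J) fun j _ => (ha0 j).le
    rwa [tsum_mul_left, ← hS, hα, inv_mul_cancel₀ hS0.ne'] at this
  have hpi := Real.pi_pos
  -- For h ≤ 2h₀ and |x| ≤ R + 1 this keeps hx / (2π) in [-1/4, 1/4].
  refine ⟨Real.pi / (4 * (R + 1)), by positivity,
    fun h n => bernoulliCoeff n * sincProd a (n * h), by simp, ?_, ?_⟩
  · intro k hk
    set h₀ := Real.pi / (4 * (R + 1)) with hh₀
    have hh₀' : 0 < h₀ := by positivity
    have hp : 0 < 1 / s := by positivity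
    obtain ⟨C, hC⟩ := exists_mul_rpow_le_add (p := 1 / s) (r := 1 / σ) (k := k / h₀ ^ (1 / s))
      (c := σ / 2 * α ^ (1 / σ)) hp (one_div_lt_one_div_of_lt hσ0 hσs) (by positivity)
      (by positivity)
    refine ⟨16 * (2 ^ σ * Real.exp C), by positivity, fun h hh n => ?_⟩
    have hh0 : 0 < h := hh₀'.trans_le hh.1
    rcases eq_or_ne n 0 with rfl | hn
    · simp; positivity
    have hn' : (n : ℝ) ≠ 0 := by exact_mod_cast hn
    have hy : (n : ℝ) * h ≠ 0 := mul_ne_zero hn' hh0.ne'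
    rw [norm_mul, Complex.norm_real, mul_assoc]
    refine mul_le_mul (norm_bernoulliCoeff_le_const n) ?_ (norm_nonneg _) (by norm_num)
    refine (abs_sincProd_rpow_le hα0 hσ1 hasum hy).trans ?_
    rw [mul_assoc, ← Real.exp_add]
    gcongr
    have h1 := hC |(n : ℝ) * h| (abs_nonneg _)
    rw [Real.mul_rpow hα0.le (abs_nonneg _)]
    have h2 : k * |(n : ℝ)| ^ (1 / s) ≤ k / h₀ ^ (1 / s) * |(n : ℝ) * h| ^ (1 / s) := by
      rw [abs_mul, Real.mul_rpow (abs_nonneg _) (abs_nonneg _), abs_of_pos hh0]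
      have h3 : h₀ ^ (1 / s) ≤ h ^ (1 / s) := Real.rpow_le_rpow hh₀'.le hh.1 hp.le
      calc k * |(n : ℝ)| ^ (1 / s) = k / h₀ ^ (1 / s) * (|(n : ℝ)| ^ (1 / s) * h₀ ^ (1 / s)) := by
            field_simp
        _ ≤ _ := by gcongr
    linarith
  · intro h hh x hx
    have hh0 : 0 < h := lt_of_lt_of_le (by positivity) hh.1
    have := hasSum_mul_sincProd (c := bernoulliCoeff) (lam := fun n : ℤ => n * h) (ρ := R + 1)
      (r := 1) ha0 hasum hsum1 summable_norm_bernoulliCoeff (fun x hx => ?_) (x := x)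
      (by simpa using hx)
    · exact this
    · have hz : |h * x / (2 * Real.pi)| ≤ 1 / 4 := by
        rw [abs_div, abs_mul, abs_of_pos hh0, abs_of_pos (by positivity : 0 < 2 * Real.pi),
          div_le_iff₀ (by positivity)]
        have h2 := hh.2
        have h3 : 2 * (Real.pi / (4 * (R + 1))) * (R + 1) = 1 / 4 * (2 * Real.pi) := by
          field_simp
        rw [← h3]
        gcongr
      convert! hasSum_bernoulliCoeff hz using 5 with n
      push_cast
      field_simp

/-! ### Products of absolutely convergent series -/

theorem summable_norm_and_hasSum_pi_prod {d : ℕ} {ι : Type*} (g : Fin d → ι → ℂ) (t : Fin d → ℂ)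
    (hs : ∀ i, Summable fun n => ‖g i n‖) (ht : ∀ i, HasSum (g i) (t i)) :
    (Summable fun m : Fin d → ι => ‖∏ i, g i (m i)‖) ∧
      HasSum (fun m : Fin d → ι => ∏ i, g i (m i)) (∏ i, t i) := by
  induction d with
  | zero => exact ⟨(hasSum_unique _).summable, by simp⟩
  | succ d ih =>
    obtain ⟨h1, h2⟩ := ih (fun i => g i.succ) (fun i => t i.succ) (fun i => hs _) fun i => ht _
    have h3 := (hs 0).mul_norm h1
    have h4 := (ht 0).mul h2 (h3.of_norm)
    constructor
    · rw [← (Fin.consEquiv (fun _ : Fin (d + 1) => ι)).summable_iff]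
      convert! h3 using 2 with p
      simp [Fin.prod_univ_succ, Fin.consEquiv]
    · rw [← (Fin.consEquiv (fun _ : Fin (d + 1) => ι)).hasSum_iff]
      convert! h4 using 2 with p
      · simp [Fin.prod_univ_succ, Fin.consEquiv]
      · rw [Fin.prod_univ_succ]

namespace Ultra

/-! ### Continuous functionals on the Gevrey space -/

/-- The underlying function of an element of the Gevrey space. -/
def GevreySpace.val (d : ℕ) (s : ℝ) : GevreySpace d s →ₗ[ℂ] (Rd d → ℂ) :=
  (gevreySubmodule d s).subtype

/-- Continuity involves finitely many seminorms, hence one ball containing all their compact sets.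
Each is dominated by ‖·‖_{s,A,K} for every A, and the single choice A = 1 is enough for plane waves.
-/
theorem exists_gevreyTerm_bound {d : ℕ} {s : ℝ} (f : CompactUltradistribution d s) :
    ∃ R C : ℝ, 0 ≤ R ∧ 0 ≤ C ∧ ∀ (φ : GevreySpace d s) (B : ℝ), 0 ≤ B →
      (∀ β x, ‖x‖ ≤ R → gevreyTerm s 1 β (GevreySpace.val d s φ) x ≤ B) → ‖f φ‖ ≤ C * B := by
  obtain ⟨S, C, -, hC⟩ := Seminorm.bound_of_continuous (gevrey_withSeminorms d s)
    ((normSeminorm ℂ ℂ).comp (f : GevreySpace d s →ₗ[ℂ] ℂ))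
    (continuous_norm.comp f.continuous)
  have hK : ∀ i : GevreySeminormIndex d s, ∃ R : ℝ, 0 ≤ R ∧ ∀ x ∈ (i.1 : Set (Rd d)), ‖x‖ ≤ R := by
    intro i
    obtain ⟨R, hR⟩ := i.1.isCompact.isBounded.exists_norm_le
    exact ⟨max R 0, le_max_right _ _, fun x hx => (hR x hx).trans (le_max_left _ _)⟩
  choose R hR0 hR using hK
  have hA : ∀ i : GevreySeminormIndex d s, _ := fun i => i.2.2 1 one_pos
  choose D hD0 hD using hA
  refine ⟨∑ i ∈ S, R i, C * ∑ i ∈ S, D i, Finset.sum_nonneg fun i _ => hR0 i,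
    mul_nonneg C.2 (Finset.sum_nonneg fun i _ => hD0 i), fun φ B hB hφ => ?_⟩
  have h1 : ‖f φ‖ ≤ C * (S.sup (gevreySeminorms d s)) φ := hC φ
  refine h1.trans ?_
  rw [mul_assoc]
  refine mul_le_mul_of_nonneg_left ?_ C.2
  refine Seminorm.finset_sup_apply_le
    (mul_nonneg (Finset.sum_nonneg fun i _ => hD0 i) hB) fun i hi => ?_
  have hle : gevreyNorm s 1 (i.1 : Set (Rd d)) (GevreySpace.val d s φ) ≤ ENNReal.ofReal B := by
    refine iSup_le fun β => iSup₂_le fun x hx => ENNReal.ofReal_le_ofReal (hφ β x ?_)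
    exact (hR i x hx).trans (Finset.single_le_sum (fun i _ => hR0 i) hi)
  have h2 := hD i (GevreySpace.toOn d s i.1 φ) (hle.trans_lt ENNReal.ofReal_lt_top)
  refine h2.trans (mul_le_mul (Finset.single_le_sum (fun i _ => hD0 i) hi)
    (ENNReal.toReal_le_of_le_ofReal hB hle) ENNReal.toReal_nonneg
    (Finset.sum_nonneg fun i _ => hD0 i))

/-! ### Gevrey estimates for plane waves -/

theorem norm_wave {d : ℕ} (ξ x : Rd d) : ‖wave ξ x‖ = 1 := by
  rw [← Complex.norm_exp_ofReal_mul_I (-(inner ℝ x ξ)), wave]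
  congr 2
  push_cast
  ring

/-- Keep one term of the exponential series at t^(1/s) and raise to the power s. This trades Gevrey
factors β!^s for growth exp(C|ξ|^(1/s)), and is the source of the rate `s` in later exponents. -/
theorem pow_le_factorial_rpow_mul_exp {s t : ℝ} (hs : 1 < s) (ht : 0 ≤ t) (N : ℕ) :
    t ^ N ≤ (N.factorial : ℝ) ^ s * Real.exp (s * t ^ (1 / s)) := by
  have hs0 : 0 < s := by linarith
  have h1 : (t ^ (1 / s)) ^ N / N.factorial ≤ Real.exp (t ^ (1 / s)) :=
    Real.pow_div_factorial_le_exp _ (by positivity) N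
  rw [div_le_iff₀ (by positivity)] at h1
  have h2 := Real.rpow_le_rpow (by positivity) h1 hs0.le
  rw [Real.mul_rpow (Real.exp_pos _).le (by positivity), ← Real.exp_mul, ← Real.rpow_natCast,
    ← Real.rpow_mul ht, ← Real.rpow_mul ht, one_div_mul_eq_div, div_mul_cancel₀ _ hs0.ne',
    Real.rpow_natCast] at h2
  rw [mul_comm, mul_comm s]
  exact h2

theorem prod_pow_le_factorial_rpow_mul_exp {d : ℕ} {s M : ℝ} (hs : 1 < s) (t : Fin d → ℝ)
    (ht : ∀ i, 0 ≤ t i) (htM : ∀ i, t i ≤ M) (β : Fin d → ℕ) :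
    ∏ i, t i ^ β i ≤
      ((∏ i, (β i).factorial : ℕ) : ℝ) ^ s * Real.exp (s * d * M ^ (1 / s)) := by
  have hs0 : 0 < s := by linarith
  calc ∏ i, t i ^ β i
      ≤ ∏ i, (((β i).factorial : ℝ) ^ s * Real.exp (s * M ^ (1 / s))) := by
        refine Finset.prod_le_prod (fun i _ => pow_nonneg (ht i) _) fun i _ => ?_
        refine (pow_le_factorial_rpow_mul_exp hs (ht i) _).trans ?_
        have h0 := ht i
        have h1 := htM i
        gcongr
    _ = _ := by
        rw [Finset.prod_mul_distrib, Finset.prod_const, ← Real.exp_nat_mul, Nat.cast_prod,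
          Real.finsetProd_rpow _ _ fun i _ => by positivity]
        simp only [Finset.card_univ, Fintype.card_fin]
        congr 2
        ring

/-- The growth function controlling `⟨f, wave ξ⟩`. -/
noncomputable def growth (d : ℕ) (s : ℝ) (ξ : Rd d) : ℝ := Real.exp (s * d * ‖ξ‖ ^ (1 / s))

theorem norm_prod_neg_I_mul_pow {d : ℕ} (ξ : Rd d) (β : Fin d → ℕ) :
    ‖∏ i, (-Complex.I * (ξ i : ℂ)) ^ β i‖ = ∏ i, |ξ i| ^ β i := by
  simp [norm_prod]

theorem norm_prod_neg_I_mul_pow_le {d : ℕ} {s : ℝ} (hs : 1 < s) (ξ : Rd d) (β : Fin d → ℕ) :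
    ‖∏ i, (-Complex.I * (ξ i : ℂ)) ^ β i‖ ≤
      ((∏ i, (β i).factorial : ℕ) : ℝ) ^ s * growth d s ξ := by
  rw [norm_prod_neg_I_mul_pow]
  exact prod_pow_le_factorial_rpow_mul_exp hs _ (fun _ => abs_nonneg _)
    (fun i => PiLp.norm_apply_le ξ i) β

theorem gevreyTerm_one_le {d : ℕ} {s B : ℝ} {β : Fin d → ℕ} {φ : Rd d → ℂ} {x : Rd d}
    (h : ‖multiDeriv β φ x‖ ≤ ((∏ i, (β i).factorial : ℕ) : ℝ) ^ s * B) :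
    gevreyTerm s 1 β φ x ≤ B := by
  have hp : 0 < ((∏ i, (β i).factorial : ℕ) : ℝ) ^ s := by
    apply Real.rpow_pos_of_pos
    exact_mod_cast Finset.prod_pos fun i _ => (β i).factorial_pos
  rw [gevreyTerm, one_pow, one_div, inv_mul_le_iff₀ hp]
  exact h

theorem exists_norm_apply_wave_le {d : ℕ} {s : ℝ} (hs : 1 < s) (f : CompactUltradistribution d s) :
    ∃ C : ℝ, 0 ≤ C ∧ ∀ ξ, ‖f (waveGevrey hs ξ)‖ ≤ C * growth d s ξ := by
  obtain ⟨R, C, -, hC, h⟩ := exists_gevreyTerm_bound f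
  refine ⟨C, hC, fun ξ => h _ _ (Real.exp_pos _).le fun β x _ => gevreyTerm_one_le ?_⟩
  change ‖multiDeriv β (wave ξ) x‖ ≤ _
  rw [multiDeriv_wave, Pi.smul_apply, norm_smul, norm_wave, mul_one]
  exact norm_prod_neg_I_mul_pow_le hs ξ β

theorem norm_wave_sub_wave_le {d : ℕ} (ξ η x : Rd d) :
    ‖wave ξ x - wave η x‖ ≤ ‖x‖ * ‖ξ - η‖ := by
  have e : wave ξ x - wave η x = wave η x *
      (Complex.exp (Complex.I * ((-inner ℝ x (ξ - η) : ℝ) : ℂ)) - 1) := by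
    rw [mul_sub, mul_one, wave, wave, ← Complex.exp_add, inner_sub_right]
    congr 2
    push_cast
    ring
  rw [e, norm_mul, norm_wave, one_mul]
  refine (Real.norm_exp_I_mul_ofReal_sub_one_le).trans ?_
  rw [norm_neg]
  exact norm_inner_le_norm x _

/-- The factor `M` on the left replaces an exponent n - 1 on the right. -/
theorem norm_pow_sub_pow_le {u v : ℂ} {M : ℝ} (hu : ‖u‖ ≤ M) (hv : ‖v‖ ≤ M)
    (n : ℕ) : M * ‖u ^ n - v ^ n‖ ≤ n * M ^ n * ‖u - v‖ := by
  have hM0 : 0 ≤ M := (norm_nonneg u).trans hu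
  induction n with
  | zero => simp
  | succ n ih =>
    have e : u ^ (n + 1) - v ^ (n + 1) = u * (u ^ n - v ^ n) + (u - v) * v ^ n := by ring
    calc M * ‖u ^ (n + 1) - v ^ (n + 1)‖
        ≤ M * (M * ‖u ^ n - v ^ n‖ + ‖u - v‖ * M ^ n) := by
          rw [e]
          gcongr
          refine (norm_add_le _ _).trans ?_
          rw [norm_mul, norm_mul, norm_pow]
          gcongr
      _ = M * (M * ‖u ^ n - v ^ n‖) + M * (‖u - v‖ * M ^ n) := by ring
      _ ≤ M * (n * M ^ n * ‖u - v‖) + M * (‖u - v‖ * M ^ n) := by gcongr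
      _ = _ := by push_cast; ring

theorem norm_prod_pow_sub_prod_pow_le {ι : Type*} (S : Finset ι) {u v : ι → ℂ} {M δ : ℝ}
    (hM : 1 ≤ M) (hu : ∀ i, ‖u i‖ ≤ M) (hv : ∀ i, ‖v i‖ ≤ M) (huv : ∀ i, ‖u i - v i‖ ≤ δ)
    (β : ι → ℕ) :
    ‖∏ i ∈ S, u i ^ β i - ∏ i ∈ S, v i ^ β i‖ ≤ (∑ i ∈ S, β i : ℕ) * M ^ (∑ i ∈ S, β i) * δ := by
  classical
  have hM0 : 0 ≤ M := by linarith
  induction S using Finset.induction_on with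
  | empty => simp
  | insert i S hi ih =>
    rw [Finset.prod_insert hi, Finset.prod_insert hi, Finset.sum_insert hi]
    have hδ : 0 ≤ δ := (norm_nonneg _).trans (huv i)
    have e : u i ^ β i * ∏ j ∈ S, u j ^ β j - v i ^ β i * ∏ j ∈ S, v j ^ β j =
        u i ^ β i * (∏ j ∈ S, u j ^ β j - ∏ j ∈ S, v j ^ β j) +
          (u i ^ β i - v i ^ β i) * ∏ j ∈ S, v j ^ β j := by ring
    have h1 : ‖u i ^ β i - v i ^ β i‖ ≤ β i * M ^ β i * δ := by
      have h := norm_pow_sub_pow_le (hu i) (hv i) (β i)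
      calc ‖u i ^ β i - v i ^ β i‖ ≤ M * ‖u i ^ β i - v i ^ β i‖ :=
            le_mul_of_one_le_left (norm_nonneg _) hM
        _ ≤ _ := h
        _ ≤ _ := by gcongr; exact huv i
    have h2 : ‖∏ j ∈ S, v j ^ β j‖ ≤ M ^ (∑ j ∈ S, β j) := by
      rw [norm_prod, ← Finset.prod_pow_eq_pow_sum]
      refine Finset.prod_le_prod (fun _ _ => norm_nonneg _) fun j _ => ?_
      rw [norm_pow]
      gcongr
      exact hv j
    rw [e]
    calc _ ≤ M ^ β i * ((∑ j ∈ S, β j : ℕ) * M ^ (∑ j ∈ S, β j) * δ) +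
          (β i * M ^ β i * δ) * M ^ (∑ j ∈ S, β j) := by
          refine (norm_add_le _ _).trans ?_
          rw [norm_mul, norm_mul, norm_pow]
          have := hu i
          gcongr
      _ = _ := by push_cast; rw [pow_add]; ring

/-- Serves the measurability of f̂. A derivative of `wave η - wave ξ` splits into the change of the
polynomial factor and the change of the wave; on the ball of radius `R` both are O(‖η - ξ‖), up to
the factor β!^s that the Gevrey norm permits. -/
theorem continuous_apply_wave {d : ℕ} {s : ℝ} (hs : 1 < s) (f : CompactUltradistribution d s) :
    Continuous fun ξ => f (waveGevrey hs ξ) := by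
  obtain ⟨R, C, hR, hC, h⟩ := exists_gevreyTerm_bound f
  rw [continuous_iff_continuousAt]
  intro ξ
  set M : ℝ := ‖ξ‖ + 1 with hM
  set B : ℝ := Real.exp (s * d * (2 * M) ^ (1 / s)) + growth d s ξ * R with hB
  have key : ∀ η : Rd d, ‖η - ξ‖ ≤ 1 →
      ‖f (waveGevrey hs η) - f (waveGevrey hs ξ)‖ ≤ C * (B * ‖η - ξ‖) := by
    intro η hη
    have hM1 : 1 ≤ M := by rw [hM]; linarith [norm_nonneg ξ]
    have hηM : ‖η‖ ≤ M := by
      have := norm_add_le (η - ξ) ξ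
      rw [sub_add_cancel] at this
      linarith
    have hg : 0 ≤ growth d s ξ := (Real.exp_pos _).le
    rw [← map_sub]
    refine h _ _ (by positivity) fun β x hx => gevreyTerm_one_le ?_
    have e : GevreySpace.val d s (waveGevrey hs η - waveGevrey hs ξ) =
        wave η + (-1 : ℂ) • wave ξ := by
      rw [map_sub, sub_eq_add_neg, neg_one_smul]; rfl
    rw [e, multiDeriv_add β (contDiff_wave η) (ψ := (-1 : ℂ) • wave ξ) ((contDiff_wave ξ).const_smul (-1 : ℂ)),
      multiDeriv_smul β _ (contDiff_wave ξ), multiDeriv_wave, multiDeriv_wave]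
    simp only [Pi.add_apply, Pi.smul_apply, smul_eq_mul]
    set P := ∏ i, (-Complex.I * (η i : ℂ)) ^ β i
    set Q := ∏ i, (-Complex.I * (ξ i : ℂ)) ^ β i
    have e2 : P * wave η x + -1 * (Q * wave ξ x) =
        (P - Q) * wave η x + Q * (wave η x - wave ξ x) := by ring
    have hb : 0 ≤ ((∏ i, (β i).factorial : ℕ) : ℝ) ^ s := by positivity
    have h1 : ‖P - Q‖ ≤ ((∏ i, (β i).factorial : ℕ) : ℝ) ^ s *
        Real.exp (s * d * (2 * M) ^ (1 / s)) * ‖η - ξ‖ := by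
      have ha : ∀ (ζ : Rd d) (i : Fin d), ‖-Complex.I * (ζ i : ℂ)‖ ≤ ‖ζ‖ := by
        intro ζ i
        simpa using PiLp.norm_apply_le ζ i
      refine (norm_prod_pow_sub_prod_pow_le Finset.univ hM1 (δ := ‖η - ξ‖)
        (fun i => (ha η i).trans hηM) (fun i => (ha ξ i).trans (by rw [hM]; linarith))
        (fun i => ?_) β).trans ?_
      · rw [← mul_sub, ← Complex.ofReal_sub]
        exact ha (η - ξ) i
      · refine mul_le_mul_of_nonneg_right ?_ (norm_nonneg _)
        -- The factor |β| is absorbed by |β| ≤ 2^|β|, whence `2 * M` in `B`.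
        have h2 := prod_pow_le_factorial_rpow_mul_exp hs (fun _ : Fin d => 2 * M)
          (fun _ => by positivity) (fun _ => le_rfl) β
        refine le_trans ?_ h2
        rw [Finset.prod_pow_eq_pow_sum, mul_pow]
        gcongr
        exact_mod_cast Nat.lt_two_pow_self.le
    rw [e2]
    calc _ ≤ ‖P - Q‖ + ‖Q‖ * (‖x‖ * ‖η - ξ‖) := by
          refine (norm_add_le _ _).trans ?_
          rw [norm_mul, norm_mul, norm_wave, mul_one]
          gcongr
          exact norm_wave_sub_wave_le η ξ x
      _ ≤ _ := by
          refine (add_le_add h1 (mul_le_mul (norm_prod_neg_I_mul_pow_le hs ξ β)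
            (mul_le_mul_of_nonneg_right hx (norm_nonneg _)) (by positivity)
            (by positivity))).trans_eq ?_
          rw [hB]
          ring
  have h0 : Tendsto (fun η : Rd d => C * (B * ‖η - ξ‖)) (𝓝 ξ) (𝓝 0) := by
    have : Continuous fun η : Rd d => C * (B * ‖η - ξ‖) := by fun_prop
    have h := this.tendsto ξ
    simpa using h
  rw [ContinuousAt, tendsto_iff_norm_sub_tendsto_zero]
  refine squeeze_zero' (Eventually.of_forall fun _ => norm_nonneg _) ?_ h0
  filter_upwards [Metric.closedBall_mem_nhds ξ one_pos] with η hη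
  exact key η (by rwa [Metric.mem_closedBall, dist_eq_norm] at hη)

/-! ### Applying functionals to exponential series -/

/-- Needed because the series below represents the test function only on a ball. -/
theorem listDeriv_eqOn {d : ℕ} {U : Set (Rd d)} (hU : IsOpen U) {φ ψ : Rd d → ℂ}
    (h : Set.EqOn φ ψ U) (β : Fin d → ℕ) (l : List (Fin d)) :
    Set.EqOn (listDeriv β l φ) (listDeriv β l ψ) U := by
  have hp : ∀ (i : Fin d) {φ ψ : Rd d → ℂ}, Set.EqOn φ ψ U →
      Set.EqOn (pderiv i φ) (pderiv i ψ) U := by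
    intro i φ ψ h x hx
    simp only [pderiv]
    rw [(h.eventuallyEq_of_mem (hU.mem_nhds hx)).fderiv_eq]
  induction l with
  | nil => exact h
  | cons i l ih =>
    change Set.EqOn ((pderiv i)^[β i] (listDeriv β l φ)) ((pderiv i)^[β i] (listDeriv β l ψ)) U
    induction β i with
    | zero => exact ih
    | succ n ihn => simp only [Function.iterate_succ_apply']; exact hp i ihn

section Series

variable {d : ℕ} {ι : Type*} {η : ι → Rd d}

theorem hasFDerivAt_wave {d : ℕ} (ξ x : Rd d) :
    HasFDerivAt (wave ξ) ((-Complex.I * wave ξ x) •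
      Complex.ofRealCLM.comp (innerSL ℝ ξ)) x := by
  have h1 : HasFDerivAt (fun x : Rd d => (inner ℝ x ξ : ℝ)) (innerSL ℝ ξ) x := by
    refine ((innerSL ℝ ξ).hasFDerivAt (x := x)).congr_of_eventuallyEq
      (Eventually.of_forall fun y => ?_)
    simp [real_inner_comm]
  have h2 := Complex.ofRealCLM.hasFDerivAt.comp x h1
  have h3 := (h2.const_mul (-Complex.I)).cexp
  convert! h3 using 1
  rw [smul_smul, mul_comm]
  rfl

theorem norm_fderiv_wave_le {d : ℕ} (ξ x : Rd d) :
    ‖(-Complex.I * wave ξ x) • Complex.ofRealCLM.comp (innerSL ℝ ξ)‖ ≤ ‖ξ‖ := by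
  rw [norm_smul, norm_mul, norm_wave, norm_neg, Complex.norm_I, one_mul, one_mul]
  refine ContinuousLinearMap.opNorm_le_bound _ (norm_nonneg _) fun y => ?_
  simpa using norm_inner_le_norm (𝕜 := ℝ) ξ y

/-- The summability hypothesis for all `N` is preserved by differentiation
(`summable_mul_neg_I_mul`), so the formula can be iterated. -/
theorem pderiv_tsum_wave {b : ι → ℂ} (hb : ∀ N : ℕ, Summable fun i => ‖b i‖ * ‖η i‖ ^ N)
    (j : Fin d) : pderiv j (fun x => ∑' i, b i * wave (η i) x) =
      fun x => ∑' i, (b i * (-Complex.I * (η i j : ℂ))) * wave (η i) x := by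
  funext x
  have h0 : Summable fun i => b i * wave (η i) x := by
    refine Summable.of_norm ?_
    simpa [norm_wave] using hb 0
  have h := hasFDerivAt_tsum (x₀ := x) (f := fun i x => b i * wave (η i) x)
    (u := fun i => ‖b i‖ * ‖η i‖)
    (f' := fun i x => b i • ((-Complex.I * wave (η i) x) •
      Complex.ofRealCLM.comp (innerSL ℝ (η i)))) (by simpa using hb 1)
    (fun i x => (hasFDerivAt_wave (η i) x).const_mul (b i))
    (fun i x => by rw [norm_smul]; gcongr; exact norm_fderiv_wave_le _ _) h0 x
  have hs : Summable fun i => b i • ((-Complex.I * wave (η i) x) •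
      Complex.ofRealCLM.comp (innerSL ℝ (η i))) := by
    refine Summable.of_norm_bounded (g := fun i => ‖b i‖ * ‖η i‖) (by simpa using hb 1) fun i => ?_
    rw [norm_smul]; gcongr; exact norm_fderiv_wave_le _ _
  rw [pderiv, h.fderiv]
  have h2 := (ContinuousLinearMap.apply ℝ ℂ (EuclideanSpace.single j (1 : ℝ) : Rd d)).map_tsum hs
  refine h2.trans (tsum_congr fun i => ?_)
  simp [EuclideanSpace.inner_single_right]
  ring

theorem summable_mul_neg_I_mul {b : ι → ℂ} (hb : ∀ N : ℕ, Summable fun i => ‖b i‖ * ‖η i‖ ^ N)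
    (j : Fin d) (N : ℕ) : Summable fun i => ‖b i * (-Complex.I * (η i j : ℂ))‖ * ‖η i‖ ^ N := by
  refine (hb (N + 1)).of_nonneg_of_le (fun _ => by positivity) fun i => ?_
  rw [norm_mul, pow_succ', mul_assoc]
  gcongr
  simpa using PiLp.norm_apply_le (η i) j

theorem iterate_pderiv_tsum_wave {b : ι → ℂ}
    (hb : ∀ N : ℕ, Summable fun i => ‖b i‖ * ‖η i‖ ^ N) (j : Fin d) (n : ℕ) :
    ((pderiv j)^[n] (fun x => ∑' i, b i * wave (η i) x) =
      fun x => ∑' i, (b i * (-Complex.I * (η i j : ℂ)) ^ n) * wave (η i) x) ∧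
      ∀ N : ℕ, Summable fun i => ‖b i * (-Complex.I * (η i j : ℂ)) ^ n‖ * ‖η i‖ ^ N := by
  induction n with
  | zero => simpa using hb
  | succ n ih =>
    constructor
    · rw [Function.iterate_succ_apply', ih.1, pderiv_tsum_wave ih.2]
      simp only [pow_succ, mul_assoc]
    · intro N
      simpa only [pow_succ, mul_assoc] using summable_mul_neg_I_mul ih.2 j N

theorem multiDeriv_tsum_wave {b : ι → ℂ}
    (hb : ∀ N : ℕ, Summable fun i => ‖b i‖ * ‖η i‖ ^ N) (β : Fin d → ℕ) :
    multiDeriv β (fun x => ∑' i, b i * wave (η i) x) =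
      fun x => ∑' i, (b i * ∏ j, (-Complex.I * (η i j : ℂ)) ^ β j) * wave (η i) x := by
  have key : ∀ l : List (Fin d),
      (listDeriv β l (fun x => ∑' i, b i * wave (η i) x) = fun x =>
        ∑' i, (b i * (l.map fun j => (-Complex.I * (η i j : ℂ)) ^ β j).prod) * wave (η i) x) ∧
      ∀ N : ℕ, Summable fun i =>
        ‖b i * (l.map fun j => (-Complex.I * (η i j : ℂ)) ^ β j).prod‖ * ‖η i‖ ^ N := by
    intro l
    induction l with
    | nil => simpa [listDeriv] using hb
    | cons j l ih =>
      have h := iterate_pderiv_tsum_wave ih.2 j (β j)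
      have e : ∀ i, b i * ((j :: l).map fun j => (-Complex.I * (η i j : ℂ)) ^ β j).prod =
          b i * (l.map fun j => (-Complex.I * (η i j : ℂ)) ^ β j).prod *
            (-Complex.I * (η i j : ℂ)) ^ β j := by
        intro i
        rw [List.map_cons, List.prod_cons]; ring
      simp_rw [e]
      refine ⟨?_, h.2⟩
      change (pderiv j)^[β j] (listDeriv β l _) = _
      rw [ih.1, h.1]
  rw [multiDeriv, (key _).1]
  simp_rw [← List.ofFn_eq_map, List.prod_ofFn]

/-- A continuous functional may be applied termwise to a rapidly convergent exponential series
which represents `wave ξ` on a large ball. -/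
theorem exists_hasSum_apply_wave {s : ℝ} (hs : 1 < s) (f : CompactUltradistribution d s) :
    ∃ R : ℝ, 0 ≤ R ∧ ∀ {ι : Type} (η : ι → Rd d) (b : ι → ℂ) (ξ : Rd d),
      (Summable fun i => ‖b i‖ * growth d s (η i)) →
      (∀ N : ℕ, Summable fun i => ‖b i‖ * ‖η i‖ ^ N) →
      (∀ x, ‖x‖ < R → HasSum (fun i => b i * wave (η i) x) (wave ξ x)) →
      HasSum (fun i => b i * f (waveGevrey hs (η i))) (f (waveGevrey hs ξ)) := by
  obtain ⟨R, C, hR, hC, h⟩ := exists_gevreyTerm_bound f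
  -- Derivatives on the closed ball of radius `R` require the identity on an open neighbourhood.
  refine ⟨R + 1, by positivity, fun {ι} η b ξ hg hb hx => ?_⟩
  set T : Finset ι → ℝ := fun F => ∑' i : {i // i ∉ F}, ‖b i‖ * growth d s (η i) with hT
  have hT0 : Tendsto (fun F => C * T F) atTop (𝓝 0) := by
    simpa using (tendsto_tsum_compl_atTop_zero fun i => ‖b i‖ * growth d s (η i)).const_mul C
  have hgr : ∀ ζ : Rd d, 0 < growth d s ζ := fun ζ => Real.exp_pos _
  rw [HasSum, tendsto_iff_norm_sub_tendsto_zero]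
  refine squeeze_zero (fun _ => norm_nonneg _) (fun F => ?_) hT0
  rw [norm_sub_rev]
  have e : f (waveGevrey hs ξ) - ∑ i ∈ F, b i * f (waveGevrey hs (η i)) =
      f (waveGevrey hs ξ - ∑ i ∈ F, b i • waveGevrey hs (η i)) := by
    rw [map_sub, map_sum]
    simp
  rw [e]
  refine h _ _ (tsum_nonneg fun i => mul_nonneg (norm_nonneg _) (hgr _).le) fun β x hxR =>
    gevreyTerm_one_le ?_
  -- The remainder after a partial sum is a global test function; on the ball, which is all that `f`
  -- sees, it is the tail of the series and can be differentiated termwise.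
  have heq : Set.EqOn
      (GevreySpace.val d s (waveGevrey hs ξ - ∑ i ∈ F, b i • waveGevrey hs (η i)))
      (fun x => ∑' i : {i // i ∉ F}, b i * wave (η i) x) (Metric.ball 0 (R + 1)) := by
    intro y hy
    have hy' := hx y (by simpa using hy)
    have e2 : GevreySpace.val d s (waveGevrey hs ξ - ∑ i ∈ F, b i • waveGevrey hs (η i)) y =
        wave ξ y - ∑ i ∈ F, b i * wave (η i) y := by
      rw [map_sub, map_sum, Pi.sub_apply, Finset.sum_apply]
      rfl
    rw [e2, ← hy'.tsum_eq, ← hy'.summable.sum_add_tsum_subtype_compl F]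
    simp
  have h1 := listDeriv_eqOn Metric.isOpen_ball heq β (List.finRange d)
    (x := x) (by simp; linarith)
  have hb' : ∀ N : ℕ, Summable fun i : {i // i ∉ F} => ‖b i‖ * ‖η i‖ ^ N := fun N =>
    (hb N).subtype _
  have hg' : Summable fun i : {i // i ∉ F} => ‖b i‖ * growth d s (η i) := hg.subtype _
  have h2 := congrFun (multiDeriv_tsum_wave hb' β) x
  rw [multiDeriv, h1]
  change ‖multiDeriv β _ x‖ ≤ _
  rw [h2, hT, ← tsum_mul_left]
  refine tsum_of_norm_bounded (hg'.mul_left _).hasSum fun i => ?_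
  rw [norm_mul, norm_mul, norm_wave, mul_one, mul_left_comm]
  gcongr
  exact norm_prod_neg_I_mul_pow_le hs _ β

end Series

/-! ### Coordinatewise multiplication by integer vectors -/

/-- `h ↦ (m i * h i)_i`. -/
noncomputable def scale {d : ℕ} (m : Fin d → ℤ) : Rd d →ₗ[ℝ] Rd d :=
  Matrix.toLpLin 2 2 (Matrix.diagonal fun i => (m i : ℝ))

@[simp] theorem scale_apply {d : ℕ} (m : Fin d → ℤ) (h : Rd d) (i : Fin d) :
    scale m h i = m i * h i := by
  simp [scale, Matrix.mulVec_diagonal]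

theorem det_scale {d : ℕ} (m : Fin d → ℤ) : LinearMap.det (scale m) = ∏ i, (m i : ℝ) := by
  rw [scale, Matrix.toLpLin_eq_toLin, LinearMap.det_toLin, Matrix.det_diagonal]

/-- The determinant is a product of nonzero integers, so the push-forward can only thin out the
volume. This is why the exponential series must have no zero frequency. -/
theorem map_scale_volume_le {d : ℕ} {m : Fin d → ℤ} (hm : ∀ i, m i ≠ 0) :
    Measure.map (scale m) (volume : Measure (Rd d)) ≤ volume := by
  have h1 : (1 : ℝ) ≤ |LinearMap.det (scale m)| := by
    rw [det_scale, Finset.abs_prod]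
    exact Finset.one_le_prod (fun i _ => by exact_mod_cast Int.one_le_abs (hm i))
  have h0 : LinearMap.det (scale m) ≠ 0 := by
    intro h
    rw [h] at h1
    norm_num at h1
  rw [Measure.map_linearMap_addHaar_eq_smul_addHaar _ h0]
  intro S
  rw [Measure.smul_apply, smul_eq_mul]
  refine mul_le_of_le_one_left zero_le ?_
  rw [← ENNReal.ofReal_one]
  refine ENNReal.ofReal_le_ofReal ?_
  rw [abs_inv]
  exact inv_le_one_of_one_le₀ h1

theorem continuous_scale {d : ℕ} (m : Fin d → ℤ) : Continuous (scale m) :=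
  (scale m).continuous_of_finiteDimensional

/-- The `ℓ¹` norm of an integer vector. -/
noncomputable def intNorm {d : ℕ} (m : Fin d → ℤ) : ℝ := ∑ i, |(m i : ℝ)|

/-- The sum of the powers `|m i| ^ (1 / s)`. -/
noncomputable def powWeight {d : ℕ} (s : ℝ) (m : Fin d → ℤ) : ℝ := ∑ i, |(m i : ℝ)| ^ (1 / s)

theorem intNorm_nonneg {d : ℕ} (m : Fin d → ℤ) : 0 ≤ intNorm m :=
  Finset.sum_nonneg fun _ _ => abs_nonneg _

theorem powWeight_nonneg {d : ℕ} (s : ℝ) (m : Fin d → ℤ) : 0 ≤ powWeight s m :=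
  Finset.sum_nonneg fun _ _ => by positivity

theorem rpow_add_le {s a b : ℝ} (hs : 1 < s) (ha : 0 ≤ a) (hb : 0 ≤ b) :
    (a + b) ^ (1 / s) ≤ a ^ (1 / s) + b ^ (1 / s) :=
  Real.rpow_add_le_add_rpow ha hb (by positivity) (by rw [div_le_one] <;> linarith)

theorem intNorm_rpow_le {d : ℕ} {s : ℝ} (hs : 1 < s) (m : Fin d → ℤ) :
    intNorm m ^ (1 / s) ≤ powWeight s m := by
  have hs0 : 0 < 1 / s := by positivity
  unfold intNorm powWeight
  induction (Finset.univ : Finset (Fin d)) using Finset.induction_on with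
  | empty => simp only [Finset.sum_empty, Real.zero_rpow hs0.ne', le_refl]
  | insert i S hi ih =>
    rw [Finset.sum_insert hi, Finset.sum_insert hi]
    exact (rpow_add_le hs (abs_nonneg _) (Finset.sum_nonneg fun _ _ => abs_nonneg _)).trans
      (by gcongr)

theorem mul_intNorm_rpow_le {d : ℕ} {s κ : ℝ} (hs : 1 < s) (hκ : 0 ≤ κ) (m : Fin d → ℤ) :
    (κ * intNorm m) ^ (1 / s) ≤ κ ^ (1 / s) * powWeight s m := by
  rw [Real.mul_rpow hκ (intNorm_nonneg m)]
  gcongr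
  exact intNorm_rpow_le hs m

/-- The box `[h₀, 2 h₀] ^ d`. -/
def box (d : ℕ) (h₀ : ℝ) : Set (Rd d) := {h | ∀ i, h i ∈ Set.Icc h₀ (2 * h₀)}

theorem isCompact_box (d : ℕ) (h₀ : ℝ) : IsCompact (box d h₀) := by
  have h := (isCompact_univ_pi fun _ : Fin d => isCompact_Icc (a := h₀) (b := 2 * h₀)).image
    (PiLp.continuous_toLp 2 fun _ : Fin d => ℝ)
  convert! h using 1
  ext x
  simp only [box, Set.mem_ofPred_eq, Set.mem_image, Set.mem_univ_pi]
  exact ⟨fun hx => ⟨x.ofLp, hx, rfl⟩, by rintro ⟨y, hy, rfl⟩; exact hy⟩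

theorem volume_box_pos (d : ℕ) {h₀ : ℝ} (hh : 0 < h₀) : 0 < volume (box d h₀) := by
  have hsub : {h : Rd d | ∀ i, h i ∈ Set.Ioo h₀ (2 * h₀)} ⊆ box d h₀ :=
    fun h hx i => Set.Ioo_subset_Icc_self (hx i)
  refine lt_of_lt_of_le (IsOpen.measure_pos _ ?_ ?_) (measure_mono hsub)
  · simp only [Set.ofPred_forall]
    exact isOpen_iInter_of_finite fun i => isOpen_Ioo.preimage (by fun_prop)
  · refine ⟨WithLp.toLp 2 fun _ => 3 / 2 * h₀, fun i => ?_⟩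
    simp only [Set.mem_Ioo]
    constructor <;> linarith

theorem norm_scale_le {d : ℕ} {h₀ : ℝ} (hh : 0 < h₀) (m : Fin d → ℤ) {h : Rd d}
    (hb : h ∈ box d h₀) : ‖scale m h‖ ≤ 2 * h₀ * intNorm m := by
  have h1 : ‖scale m h‖ ≤ ∑ i, |scale m h i| := by
    rw [EuclideanSpace.norm_eq, Real.sqrt_le_left (Finset.sum_nonneg fun _ _ => abs_nonneg _)]
    exact Finset.sum_sq_le_sq_sum_of_nonneg fun _ _ => abs_nonneg _
  refine h1.trans ?_
  rw [intNorm, Finset.mul_sum]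
  refine Finset.sum_le_sum fun i _ => ?_
  rw [scale_apply, abs_mul, mul_comm, abs_of_pos (hh.trans_le (hb i).1)]
  gcongr
  exact (hb i).2

theorem norm_scale_rpow_le {d : ℕ} {s h₀ : ℝ} (hs : 1 < s) (hh : 0 < h₀) (m : Fin d → ℤ) {h : Rd d}
    (hb : h ∈ box d h₀) : ‖scale m h‖ ^ (1 / s) ≤ (2 * h₀) ^ (1 / s) * powWeight s m :=
  (Real.rpow_le_rpow (norm_nonneg _) (norm_scale_le hh m hb) (by positivity)).trans
    (mul_intNorm_rpow_le hs (by positivity) m)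

/-- In each coordinate, the case N = 2 of `pow_le_factorial_rpow_mul_exp` compares with 1/n². -/
theorem summable_exp_neg_powWeight {d : ℕ} {s : ℝ} (hs : 1 < s) :
    Summable fun m : Fin d → ℤ => Real.exp (-(s * powWeight s m)) := by
  have h1 : Summable fun n : ℤ => Real.exp (-(s * |(n : ℝ)| ^ (1 / s))) := by
    have h2 := (Real.summable_one_div_int_pow.2 one_lt_two).mul_left ((Nat.factorial 2 : ℝ) ^ s)
    have h3 : Summable fun n : ℤ => (if n = 0 then 1 else 0 : ℝ) :=
      summable_of_ne_finset_zero (s := {0}) (by intro n hn; simpa using hn)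
    refine (h2.add h3).of_nonneg_of_le (fun _ => (Real.exp_pos _).le) fun n => ?_
    rcases eq_or_ne n 0 with rfl | hn
    · simp; positivity
    have h4 := pow_le_factorial_rpow_mul_exp hs (abs_nonneg (n : ℝ)) 2
    rw [sq_abs] at h4
    have h5 : (0 : ℝ) < (n : ℝ) ^ 2 := by positivity
    rw [if_neg hn, add_zero, mul_one_div, le_div_iff₀ h5, Real.exp_neg,
      inv_mul_le_iff₀ (Real.exp_pos _), mul_comm]
    exact h4
  have h2 := (summable_norm_and_hasSum_pi_prod (d := d)
    (fun _ (n : ℤ) => ((Real.exp (-(s * |(n : ℝ)| ^ (1 / s))) : ℝ) : ℂ)) _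
    (fun _ => by simpa only [Complex.norm_real, Real.norm_eq_abs, Real.abs_exp] using h1)
    (fun _ => (Complex.hasSum_ofReal.2 h1.hasSum))).1
  refine h2.congr fun m => ?_
  rw [norm_prod]
  simp only [Complex.norm_real, Real.norm_eq_abs, Real.abs_exp]
  rw [← Real.exp_sum, powWeight, Finset.mul_sum, Finset.sum_neg_distrib]

/-! ### Reproducing formula -/

theorem exists_fourier_series {d : ℕ} {s : ℝ} (hs : 1 < s) (f : CompactUltradistribution d s) :
    ∃ h₀ : ℝ, 0 < h₀ ∧ ∃ c : Rd d → (Fin d → ℤ) → ℂ,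
      (∀ h m i, m i = 0 → c h m = 0) ∧
      (∀ k : ℝ, 0 < k → ∃ C : ℝ, 0 < C ∧ ∀ h ∈ box d h₀, ∀ m,
        ‖c h m‖ ≤ C * Real.exp (-(k * powWeight s m))) ∧
      ∀ h ∈ box d h₀, ∀ ξ,
        HasSum (fun m => c h m * fourier hs f (ξ + scale m h)) (fourier hs f ξ) := by
  have hs0 : 0 < s := by linarith
  obtain ⟨R, hR, hf⟩ := exists_hasSum_apply_wave hs f
  obtain ⟨h₀, hh₀, c, hc0, hck, hcs⟩ := exists_exponential_series_eq_one hs hR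
  have hbound : ∀ k : ℝ, 0 < k → ∃ C : ℝ, 0 < C ∧ ∀ h ∈ box d h₀, ∀ m : Fin d → ℤ,
      ‖∏ i, c (h i) (m i)‖ ≤ C * Real.exp (-(k * powWeight s m)) := by
    intro k hk
    obtain ⟨C, hC, h⟩ := hck k hk
    refine ⟨C ^ d, by positivity, fun h' hh' m => ?_⟩
    rw [norm_prod]
    refine (Finset.prod_le_prod (fun _ _ => norm_nonneg _)
      fun i _ => h (h' i) (hh' i) (m i)).trans_eq ?_
    rw [Finset.prod_mul_distrib, Finset.prod_const, ← Real.exp_sum, powWeight, Finset.mul_sum,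
      Finset.sum_neg_distrib]
    simp
  refine ⟨h₀, hh₀, fun h m => ∏ i, c (h i) (m i), fun h m i hi =>
    Finset.prod_eq_zero (Finset.mem_univ i) (by rw [hi, hc0]), hbound, fun h hh ξ => ?_⟩
  have hexp : ∀ k : ℝ, 0 < k →
      Summable fun m : Fin d → ℤ => ‖∏ i, c (h i) (m i)‖ *
        Real.exp (k * ‖ξ + scale m h‖ ^ (1 / s)) := by
    intro k hk
    -- The first part of the rate cancels the growth in `scale m h`; the remaining `s` gives
    -- summability.
    obtain ⟨C, hC, hb⟩ := hbound (k * (2 * h₀) ^ (1 / s) + s) (by positivity)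
    refine ((summable_exp_neg_powWeight (d := d) hs).mul_left
      (C * Real.exp (k * ‖ξ‖ ^ (1 / s)))).of_nonneg_of_le (fun _ => by positivity) fun m => ?_
    have h1 : ‖ξ + scale m h‖ ^ (1 / s) ≤
        ‖ξ‖ ^ (1 / s) + (2 * h₀) ^ (1 / s) * powWeight s m := by
      refine (Real.rpow_le_rpow (norm_nonneg _) (norm_add_le _ _) (by positivity)).trans ?_
      refine (rpow_add_le hs (norm_nonneg _) (norm_nonneg _)).trans ?_
      gcongr
      exact norm_scale_rpow_le hs hh₀ m hh
    calc _ ≤ (C * Real.exp (-((k * (2 * h₀) ^ (1 / s) + s) * powWeight s m))) *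
          Real.exp (k * (‖ξ‖ ^ (1 / s) + (2 * h₀) ^ (1 / s) * powWeight s m)) := by
            gcongr
            exact hb h hh m
      _ = _ := by
        rw [mul_assoc, mul_assoc, ← Real.exp_add, ← Real.exp_add]
        congr 2
        ring
  have key := hf (fun m : Fin d → ℤ => ξ + scale m h) (fun m => ∏ i, c (h i) (m i)) ξ ?_ ?_ ?_
  · have := key.mul_left (((2 * Real.pi) ^ (-(d : ℝ) / 2) : ℝ) : ℂ)
    convert! this using 2 with m
    rw [fourier]
    ring
  -- For d = 0 the rate `s * d` is not positive, but there is only one index.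
  · rcases Nat.eq_zero_or_pos d with rfl | hd
    · exact (hasSum_unique _).summable
    · exact hexp (s * d) (by positivity)
  · intro N
    refine ((hexp s hs0).mul_left ((N.factorial : ℝ) ^ s)).of_nonneg_of_le
      (fun _ => by positivity) fun m => ?_
    rw [mul_left_comm]
    gcongr
    exact pow_le_factorial_rpow_mul_exp hs (norm_nonneg _) N
  · intro x hx
    -- Waves carry the sign of exp(-i⟨x, ξ⟩), so the one-dimensional series are evaluated at `-(x
    -- i)`.
    have hx' : ∀ i, |-(x i)| ≤ R := fun i => by
      rw [abs_neg]; exact (PiLp.norm_apply_le x i).trans hx.le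
    have h1 : ∀ i, Summable fun n : ℤ =>
        ‖c (h i) n * Complex.exp ((n * h i * -(x i) : ℝ) * Complex.I)‖ := fun i =>
      (hcs (h i) (hh i) _ (hx' i)).summable.norm
    have h2 := (summable_norm_and_hasSum_pi_prod _ _ h1
      fun i => hcs (h i) (hh i) _ (hx' i)).2.mul_right (wave ξ x)
    rw [Finset.prod_const_one, one_mul] at h2
    convert! h2 using 2 with m
    rw [Finset.prod_mul_distrib, ← Complex.exp_sum, mul_assoc]
    congr 1
    rw [wave, wave, ← Complex.exp_add, inner_add_right]
    congr 1
    have h3 : inner ℝ x (scale m h) = ∑ i, (m i : ℝ) * h i * x i := by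
      simp [PiLp.inner_apply]
    rw [h3, ← Finset.sum_mul]
    push_cast
    simp only [mul_neg, Finset.sum_neg_distrib]
    ring

/-! ### Lattice points in balls -/

theorem sum_indicator_int_le {d : ℕ} {r : ℝ} (hr : 0 ≤ r) (b : Fin d → ℝ) :
    ∑' a : Fin d → ℤ, {a : Fin d → ℤ | ∀ i, |(a i : ℝ) - b i| ≤ r}.indicator (1 : (Fin d → ℤ) → ℝ≥0∞) a ≤
      ENNReal.ofReal ((2 * r + 1) ^ d) := by
  set F : Finset (Fin d → ℤ) := Fintype.piFinset fun i => Finset.Icc ⌈b i - r⌉ ⌊b i + r⌋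
  have hF : ∀ a, a ∉ F →
      {a : Fin d → ℤ | ∀ i, |(a i : ℝ) - b i| ≤ r}.indicator (1 : (Fin d → ℤ) → ℝ≥0∞) a = 0 := by
    intro a ha
    refine Set.indicator_of_notMem (fun h => ha ?_) _
    refine Fintype.mem_piFinset.2 fun i => Finset.mem_Icc.2 ?_
    have := abs_le.1 (h i)
    exact ⟨Int.ceil_le.2 (by linarith), Int.le_floor.2 (by linarith)⟩
  rw [tsum_eq_sum fun a ha => hF a ha]
  calc _ ≤ ∑ a ∈ F, (1 : ℝ≥0∞) := Finset.sum_le_sum fun a _ =>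
        Set.indicator_le_self' (fun _ _ => zero_le) a
    _ = ENNReal.ofReal (F.card : ℝ) := by simp
    _ ≤ _ := by
      refine ENNReal.ofReal_le_ofReal ?_
      rw [Fintype.card_piFinset, Nat.cast_prod]
      have h1 : ∀ i, ((Finset.Icc ⌈b i - r⌉ ⌊b i + r⌋).card : ℝ) ≤ 2 * r + 1 := by
        intro i
        rw [Int.card_Icc]
        have h2 := Int.le_ceil (b i - r)
        have h3 := Int.floor_le (b i + r)
        rcases le_total (⌊b i + r⌋ + 1 - ⌈b i - r⌉) 0 with h | h
        · rw [Int.toNat_of_nonpos h]; simp; positivity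
        · have h4 : (((⌊b i + r⌋ + 1 - ⌈b i - r⌉).toNat : ℤ) : ℝ) =
              ((⌊b i + r⌋ + 1 - ⌈b i - r⌉ : ℤ) : ℝ) := by rw [Int.toNat_of_nonneg h]
          rw [Int.cast_natCast] at h4
          rw [h4]
          push_cast
          linarith
      refine (Finset.prod_le_prod (fun _ _ => by positivity) fun i _ => h1 i).trans_eq ?_
      simp

theorem IsLattice.countable {d : ℕ} {Λ : Set (Rd d)} (hΛ : IsLattice Λ) : Λ.Countable := by
  obtain ⟨e, rfl⟩ := hΛ
  refine (Set.countable_range fun a : Fin d → ℤ => ∑ i, (a i : ℝ) • e i).mono ?_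
  rintro x ⟨a, rfl⟩
  exact ⟨a, rfl⟩

/-- In lattice coordinates the ball lies in a cube of half-side M r, so the count is polynomial in
r. It is weakened to an exponential of r^(1/s), the form that `expWeight` absorbs. -/
theorem IsLattice.exists_sum_indicator_le {d : ℕ} {s : ℝ} (hs : 1 < s) {Λ : Set (Rd d)}
    (hΛ : IsLattice Λ) : ∃ K C : ℝ, 0 < K ∧ 0 < C ∧ ∀ (y : Rd d) (r : ℝ), 0 ≤ r →
      ∑' ξ : Λ, (Metric.closedBall (ξ : Rd d) r).indicator (1 : Rd d → ℝ≥0∞) y ≤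
        ENNReal.ofReal (C * Real.exp ((K * r) ^ (1 / s))) := by
  have hs0 : 0 < s := by linarith
  obtain ⟨e, rfl⟩ := hΛ
  set T : Rd d →L[ℝ] (Fin d → ℝ) := LinearMap.toContinuousLinearMap e.equivFun.toLinearMap
  set M := ‖T‖ + 1
  have hM : 0 < M := by positivity
  have hT : ∀ x i, |e.equivFun x i| ≤ M * ‖x‖ := by
    intro x i
    refine (norm_le_pi_norm (T x) i).trans ((T.le_opNorm x).trans ?_)
    gcongr
    linarith
  -- Under the power 1/s the factor `s ^ s` becomes `s`; `Real.exp s` pays for the 1 in 2Mr + 1.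
  refine ⟨s ^ s * (2 * M), (d.factorial : ℝ) ^ s * Real.exp s, by positivity, by positivity,
    fun y r hr => ?_⟩
  set φ : (Fin d → ℤ) → {x | ∃ a : Fin d → ℤ, x = ∑ i, (a i : ℝ) • e i} :=
    fun a => ⟨∑ i, (a i : ℝ) • e i, a, rfl⟩
  have hφ : Function.Surjective φ := by
    rintro ⟨x, a, rfl⟩
    exact ⟨a, rfl⟩
  refine (ENNReal.tsum_le_tsum_comp_of_surjective hφ _).trans ?_
  have h1 := sum_indicator_int_le (d := d) (r := M * r) (by positivity) (e.equivFun y)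
  refine (ENNReal.tsum_le_tsum fun a => ?_).trans (h1.trans (ENNReal.ofReal_le_ofReal ?_))
  · by_cases hy' : y ∈ Metric.closedBall (φ a : Rd d) r
    swap
    · rw [Set.indicator_of_notMem hy']
      exact zero_le
    rw [Set.indicator_of_mem hy', Set.indicator_of_mem]
    · rfl
    · intro i
      have h2 := hT (∑ j, (a j : ℝ) • e j - y) i
      rw [map_sub, Pi.sub_apply] at h2
      have h3 : e.equivFun (∑ j, (a j : ℝ) • e j) i = a i := by
        simp [Finsupp.single_apply]
      rw [h3] at h2
      refine h2.trans ?_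
      gcongr
      rw [← dist_eq_norm, dist_comm]
      exact hy'
  · refine (pow_le_factorial_rpow_mul_exp hs (by positivity) d).trans ?_
    rw [mul_assoc, ← Real.exp_add]
    gcongr
    have h2 := rpow_add_le hs (a := 2 * (M * r)) (b := 1) (by positivity) zero_le_one
    rw [Real.one_rpow] at h2
    have h3 : (s ^ s * (2 * M) * r) ^ (1 / s) = s * (2 * (M * r)) ^ (1 / s) := by
      rw [mul_assoc, Real.mul_rpow (by positivity) (by positivity), ← Real.rpow_mul hs0.le,
        mul_one_div_cancel hs0.ne', Real.rpow_one, mul_assoc]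
    rw [h3]
    nlinarith

/-! ### Integration over the box -/

/-- Substitute y = ξ + `scale m h`: the box lands in the indicated ball, and the push-forward is at
most Lebesgue measure. -/
theorem lintegral_box_le {d : ℕ} {h₀ : ℝ} (hh : 0 < h₀) {m : Fin d → ℤ} (hm : ∀ i, m i ≠ 0)
    {Φ : Rd d → ℝ≥0∞} (hΦ : Measurable Φ) (ξ : Rd d) :
    ∫⁻ h in box d h₀, Φ (ξ + scale m h) ≤
      ∫⁻ y, (Metric.closedBall ξ (2 * h₀ * intNorm m)).indicator 1 y * Φ y := by
  set G : Rd d → ℝ≥0∞ := fun y => (Metric.closedBall ξ (2 * h₀ * intNorm m)).indicator 1 y * Φ y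
  have hG : Measurable G :=
    (measurable_one.indicator Metric.isClosed_closedBall.measurableSet).mul hΦ
  calc ∫⁻ h in box d h₀, Φ (ξ + scale m h)
      ≤ ∫⁻ h in box d h₀, G (ξ + scale m h) := by
        refine setLIntegral_mono' (isCompact_box d h₀).isClosed.measurableSet fun h hb => ?_
        simp only [G]
        rw [Set.indicator_of_mem]
        · simp
        · simpa [dist_eq_norm] using norm_scale_le hh m hb
    _ ≤ ∫⁻ h, G (ξ + scale m h) := setLIntegral_le_lintegral _ _
    _ = ∫⁻ y, G (ξ + y) ∂(Measure.map (scale m) volume) := by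
        exact (lintegral_map (hG.comp (measurable_const_add ξ)) (continuous_scale m).measurable).symm
    _ ≤ ∫⁻ y, G (ξ + y) := lintegral_mono' (map_scale_volume_le hm) le_rfl
    _ = ∫⁻ y, G y := lintegral_add_left_eq_self G ξ

/-- After exchanging sum and integral, each y is counted at most `N` times. -/
theorem tsum_lintegral_box_le {d : ℕ} {h₀ : ℝ} (hh : 0 < h₀) {m : Fin d → ℤ} (hm : ∀ i, m i ≠ 0)
    {Φ : Rd d → ℝ≥0∞} (hΦ : Measurable Φ) {Λ : Set (Rd d)} (hΛ : Λ.Countable) {N : ℝ≥0∞}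
    (hN : ∀ y, ∑' ξ : Λ, (Metric.closedBall (ξ : Rd d) (2 * h₀ * intNorm m)).indicator
      (1 : Rd d → ℝ≥0∞) y ≤ N) :
    ∑' ξ : Λ, ∫⁻ h in box d h₀, Φ (ξ + scale m h) ≤ N * ∫⁻ y, Φ y := by
  have := hΛ.to_subtype
  calc _ ≤ ∑' ξ : Λ, ∫⁻ y, (Metric.closedBall (ξ : Rd d) (2 * h₀ * intNorm m)).indicator 1 y * Φ y :=
        ENNReal.tsum_le_tsum fun ξ => lintegral_box_le hh hm hΦ ξ
    _ = ∫⁻ y, ∑' ξ : Λ, (Metric.closedBall (ξ : Rd d) (2 * h₀ * intNorm m)).indicator 1 y * Φ y := by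
        rw [lintegral_tsum]
        intro ξ
        exact ((measurable_one.indicator Metric.isClosed_closedBall.measurableSet).mul
          hΦ).aemeasurable
    _ ≤ ∫⁻ y, N * Φ y := by
        refine lintegral_mono fun y => ?_
        rw [ENNReal.tsum_mul_right]
        gcongr
        exact hN y
    _ = N * ∫⁻ y, Φ y := lintegral_const_mul _ hΦ

/-! ### Cones and weights -/

/-- The closure of Γ₀ meets the unit sphere in a compact subset of the open set Γ, which has a
uniform thickening inside Γ; homogeneity does the rest. -/
theorem IsOpenCone.exists_pos_forall_mem {d : ℕ} {Γ Γ₀ : Set (Rd d)} (hΓ : IsOpenCone Γ)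
    (hΓ₀ : IsOpenCone Γ₀) (hsub : closure Γ₀ \ {0} ⊆ Γ) :
    ∃ c : ℝ, 0 < c ∧ ∀ ξ ∈ Γ₀, ∀ η : Rd d, ‖η‖ ≤ c * ‖ξ‖ → ξ + η ∈ Γ := by
  have hK : IsCompact (closure Γ₀ ∩ Metric.sphere (0 : Rd d) 1) :=
    (isCompact_sphere 0 1).inter_left isClosed_closure
  have hKΓ : closure Γ₀ ∩ Metric.sphere (0 : Rd d) 1 ⊆ Γ := by
    rintro x ⟨hx, hx1⟩
    refine hsub ⟨hx, ?_⟩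
    rintro rfl
    simp at hx1
  obtain ⟨c, hc, hcΓ⟩ := hK.exists_cthickening_subset_open hΓ.1 hKΓ
  refine ⟨c, hc, fun ξ hξ η hη => ?_⟩
  have hξ0 : 0 < ‖ξ‖ := norm_pos_iff.2 fun h => hΓ₀.2.1 (h ▸ hξ)
  have h1 : ‖ξ‖⁻¹ • (ξ + η) ∈ Γ := by
    refine hcΓ (Metric.mem_cthickening_of_dist_le _ (‖ξ‖⁻¹ • ξ) _ _ ⟨?_, ?_⟩ ?_)
    · exact subset_closure (hΓ₀.2.2 ξ hξ _ (by positivity))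
    · simp [norm_smul, hξ0.ne']
    · rw [dist_eq_norm, smul_add, add_sub_cancel_left, norm_smul, norm_inv, norm_norm,
        inv_mul_le_iff₀ hξ0, mul_comm]
      exact hη
  have h2 := hΓ.2.2 _ h1 ‖ξ‖ hξ0
  rwa [smul_smul, mul_inv_cancel₀ hξ0.ne', one_smul] at h2

theorem IsRoumieuWeight.exists_le {d : ℕ} {s : ℝ} {ω : Rd d → ℝ} (hω : IsRoumieuWeight s ω) :
    ∃ C k : ℝ, 0 < C ∧ 0 < k ∧ ∀ x y, ω (x + y) ≤ C * Real.exp (k * ‖x‖ ^ (1 / s)) * ω y := by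
  obtain ⟨hω0, v, -, -, ⟨C, k, hC, hk, hv⟩, c, hc, h⟩ := hω
  refine ⟨c * C, k, by positivity, hk, fun x y => (h x y).trans ?_⟩
  have := hω0 y
  rw [mul_assoc c, mul_assoc c]
  gcongr
  exact hv x

/-- A lower semicontinuous majorant of a weight. -/
noncomputable def ballSup {d : ℕ} (ω : Rd d → ℝ) (x : Rd d) : ℝ≥0∞ :=
  ⨆ y ∈ Metric.ball x 1, ENNReal.ofReal (ω y)

/-- The weight itself need not be measurable; superlevel sets of its supremum over unit balls are
unions of such balls, hence open. -/
theorem measurable_ballSup {d : ℕ} (ω : Rd d → ℝ) : Measurable (ballSup ω) := by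
  refine measurable_of_Ioi fun a => IsOpen.measurableSet ?_
  have : ballSup ω ⁻¹' Set.Ioi a = ⋃ y ∈ {y | a < ENNReal.ofReal (ω y)}, Metric.ball y 1 := by
    ext x
    simp only [ballSup, Set.mem_preimage, Set.mem_Ioi, lt_iSup_iff, Set.mem_iUnion,
      Set.mem_ofPred_eq, exists_prop, Metric.mem_ball]
    exact ⟨fun ⟨y, h1, h2⟩ => ⟨y, h2, by rwa [dist_comm]⟩,
      fun ⟨y, h1, h2⟩ => ⟨y, by rwa [dist_comm], h1⟩⟩
  rw [this]
  exact isOpen_biUnion fun _ _ => Metric.isOpen_ball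

theorem ofReal_le_ballSup {d : ℕ} (ω : Rd d → ℝ) (x : Rd d) : ENNReal.ofReal (ω x) ≤ ballSup ω x :=
  le_iSup₂_of_le x (Metric.mem_ball_self one_pos) le_rfl

/-- By moderateness, a shift of length below 1 changes the weight by a bounded factor. -/
theorem IsRoumieuWeight.exists_ballSup_le {d : ℕ} {s : ℝ} (hs : 1 < s) {ω : Rd d → ℝ}
    (hω : IsRoumieuWeight s ω) :
    ∃ C : ℝ, 0 < C ∧ ∀ x, ballSup ω x ≤ ENNReal.ofReal C * ENNReal.ofReal (ω x) := by
  obtain ⟨C, k, hC, hk, h⟩ := hω.exists_le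
  refine ⟨C * Real.exp k, by positivity, fun x => iSup₂_le fun y hy => ?_⟩
  rw [← ENNReal.ofReal_mul (by positivity)]
  refine ENNReal.ofReal_le_ofReal ?_
  have h1 := h (y - x) x
  rw [sub_add_cancel] at h1
  refine h1.trans ?_
  have := hω.1 x
  gcongr
  refine mul_le_of_le_one_right hk.le (Real.rpow_le_one (norm_nonneg _) ?_ (by positivity))
  rw [Metric.mem_ball, dist_eq_norm] at hy
  exact hy.le

/-! ### The pointwise estimate on the smaller cone -/

theorem continuous_fourier {d : ℕ} {s : ℝ} (hs : 1 < s) (f : CompactUltradistribution d s) :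
    Continuous (fourier hs f) :=
  continuous_const.mul (continuous_apply_wave hs f)

theorem exists_norm_fourier_le {d : ℕ} {s : ℝ} (hs : 1 < s) (f : CompactUltradistribution d s) :
    ∃ C : ℝ, 0 ≤ C ∧ ∀ ξ, ‖fourier hs f ξ‖ ≤ C * growth d s ξ := by
  obtain ⟨C, hC, h⟩ := exists_norm_apply_wave_le hs f
  refine ⟨‖(((2 * Real.pi) ^ (-(d : ℝ) / 2) : ℝ) : ℂ)‖ * C, by positivity, fun ξ => ?_⟩
  rw [fourier, norm_mul, mul_assoc]
  gcongr
  exact h ξ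

/-- The function `f^ ω`, localized to `Γ`, with `ω` replaced by its measurable majorant. -/
noncomputable def localized {d : ℕ} {s : ℝ} (hs : 1 < s) (f : CompactUltradistribution d s)
    (ω : Rd d → ℝ) (Γ : Set (Rd d)) : Rd d → ℝ≥0∞ :=
  Γ.indicator fun y => ‖fourier hs f y‖ₑ * ballSup ω y

theorem measurable_localized {d : ℕ} {s : ℝ} (hs : 1 < s) (f : CompactUltradistribution d s)
    (ω : Rd d → ℝ) {Γ : Set (Rd d)} (hΓ : IsOpen Γ) : Measurable (localized hs f ω Γ) :=
  ((continuous_fourier hs f).measurable.enorm.mul (measurable_ballSup ω)).indicator hΓ.measurableSet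

theorem enorm_mul_ofReal {z : ℂ} {t : ℝ} (ht : 0 ≤ t) :
    ‖z * (t : ℂ)‖ₑ = ‖z‖ₑ * ENNReal.ofReal t := by
  rw [enorm_mul, ← ofReal_norm (t : ℂ), Complex.norm_real, Real.norm_of_nonneg ht]

/-- Exponential weights on the integer vectors without vanishing coordinate. -/
noncomputable def expWeight {d : ℕ} (s K : ℝ) (m : Fin d → ℤ) : ℝ≥0∞ :=
  {m : Fin d → ℤ | ∀ i, m i ≠ 0}.indicator
    (fun m => ENNReal.ofReal (Real.exp (-(K * powWeight s m)))) m

theorem expWeight_eq_zero {d : ℕ} (s K : ℝ) {m : Fin d → ℤ} (hm : ¬∀ i, m i ≠ 0) :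
    expWeight s K m = 0 :=
  Set.indicator_of_notMem (s := {m : Fin d → ℤ | ∀ i, m i ≠ 0}) hm _

/-- Each term of the reproducing formula either has ξ + `scale m h` in Γ or forces ‖ξ‖ ≤ ρ |m|. The
second case is recorded as a ball about ξ containing 0, so that the lattice count also bounds its
sum over ξ. -/
theorem exists_enorm_fourier_mul_le {d : ℕ} {s : ℝ} (hs : 1 < s) (f : CompactUltradistribution d s)
    {ω : Rd d → ℝ} (hω : IsRoumieuWeight s ω) {Γ Γ₀ : Set (Rd d)} (hΓ : IsOpenCone Γ)
    (hΓ₀ : IsOpenCone Γ₀) (hsub : closure Γ₀ \ {0} ⊆ Γ) :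
    ∃ h₀ ρ : ℝ, 0 < h₀ ∧ 0 < ρ ∧ ∀ K : ℝ, 0 < K → ∃ D : ℝ, 0 < D ∧ ∀ ξ ∈ Γ₀, ∀ h ∈ box d h₀,
      ‖fourier hs f ξ * (ω ξ : ℂ)‖ₑ ≤ ENNReal.ofReal D * ∑' m : Fin d → ℤ, expWeight s K m *
        ((Metric.closedBall ξ (ρ * intNorm m)).indicator 1 0 +
          localized hs f ω Γ (ξ + scale m h)) := by
  have hs0 : 0 < s := by linarith
  obtain ⟨h₀, hh₀, b, hb0, hbK, hsum⟩ := exists_fourier_series hs f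
  obtain ⟨c, hc, hcone⟩ := hΓ.exists_pos_forall_mem hΓ₀ hsub
  obtain ⟨Cω, k, hCω, hk, hωle⟩ := hω.exists_le
  obtain ⟨Cf, hCf, hfle⟩ := exists_norm_fourier_le hs f
  have hω0 := hω.1
  refine ⟨h₀, 2 * h₀ / c, hh₀, by positivity, fun K hK => ?_⟩
  set ρ := 2 * h₀ / c with hρ
  -- `a₁` pays for moving ω from ξ + `scale m h` back to ξ; `a₂` pays for the growth of f̂ and ω
  -- when ξ is small compared with m.
  set a₁ := k * (2 * h₀) ^ (1 / s) with ha₁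
  set a₂ := (s * d + k) * ρ ^ (1 / s) + s * d * (2 * h₀) ^ (1 / s) with ha₂
  have ha₁0 : 0 ≤ a₁ := by positivity
  have ha₂0 : 0 ≤ a₂ := by positivity
  obtain ⟨Cb, hCb, hb⟩ := hbK (K + a₁ + a₂) (by positivity)
  -- In the last factor, 1 serves the terms in Γ and `Cf * ω 0` the others.
  have hD : 0 < Cb * Cω * (1 + Cf * ω 0) := by
    have := mul_nonneg hCf (hω0 0)
    positivity
  refine ⟨_, hD, fun ξ hξ h hh => ?_⟩
  have h1 : ‖fourier hs f ξ * (ω ξ : ℂ)‖ₑ ≤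
      ∑' m, ‖b h m * fourier hs f (ξ + scale m h)‖ₑ * ENNReal.ofReal (ω ξ) := by
    rw [enorm_mul_ofReal (hω0 ξ), ENNReal.tsum_mul_right, ← (hsum h hh ξ).tsum_eq]
    gcongr
    exact enorm_tsum_le_tsum_enorm
  rw [← ENNReal.tsum_mul_left]
  refine h1.trans (ENNReal.tsum_le_tsum fun m => ?_)
  by_cases hm : ∀ i, m i ≠ 0
  swap
  · push Not at hm
    obtain ⟨i, hi⟩ := hm
    rw [hb0 h m i hi]
    simp
  have hbm := hb h hh m
  set μ := powWeight s m with hμ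
  have hμ0 : 0 ≤ μ := powWeight_nonneg s m
  have hscale := norm_scale_rpow_le hs hh₀ m hh
  rw [← hμ] at hscale
  have hexpW : expWeight s K m = ENNReal.ofReal (Real.exp (-(K * μ))) :=
    Set.indicator_of_mem (s := {m : Fin d → ℤ | ∀ i, m i ≠ 0}) hm _
  have hCD : 1 ≤ 1 + Cf * ω 0 := by
    have := mul_nonneg hCf (hω0 0)
    linarith
  rw [hexpW, ← mul_assoc, ← ENNReal.ofReal_mul hD.le]
  by_cases hgood : ‖scale m h‖ ≤ c * ‖ξ‖
  · have hmem : ξ + scale m h ∈ Γ := hcone ξ hξ _ hgood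
    refine le_trans ?_ (mul_le_mul_right (le_add_left le_rfl) _)
    rw [localized, Set.indicator_of_mem hmem, enorm_mul]
    have h2 : ‖b h m‖ * ω ξ ≤
        Cb * Cω * (1 + Cf * ω 0) * Real.exp (-(K * μ)) * ω (ξ + scale m h) := by
      have h3 := hωle (-(scale m h)) (ξ + scale m h)
      rw [neg_add_cancel_comm_assoc, norm_neg] at h3
      have h4 := hω0 (ξ + scale m h)
      have h5 : -((K + a₁ + a₂) * μ) + k * ‖scale m h‖ ^ (1 / s) ≤ -(K * μ) := by
        have h6 : k * ‖scale m h‖ ^ (1 / s) ≤ a₁ * μ := by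
          rw [ha₁, mul_assoc]
          exact mul_le_mul_of_nonneg_left hscale hk.le
        have h7 : 0 ≤ a₂ * μ := by positivity
        linarith
      calc ‖b h m‖ * ω ξ
          ≤ (Cb * Real.exp (-((K + a₁ + a₂) * μ))) *
            (Cω * Real.exp (k * ‖scale m h‖ ^ (1 / s)) * ω (ξ + scale m h)) := by
              gcongr
              exact hω0 ξ
        _ = Cb * Cω * Real.exp (-((K + a₁ + a₂) * μ) + k * ‖scale m h‖ ^ (1 / s)) *
            ω (ξ + scale m h) := by rw [Real.exp_add]; ring
        _ ≤ Cb * Cω * Real.exp (-(K * μ)) * ω (ξ + scale m h) := by gcongr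
        _ ≤ Cb * Cω * (1 + Cf * ω 0) * Real.exp (-(K * μ)) * ω (ξ + scale m h) := by
              refine mul_le_mul_of_nonneg_right (mul_le_mul_of_nonneg_right ?_
                (Real.exp_pos _).le) h4
              exact le_mul_of_one_le_right (by positivity) hCD
    calc _ = ENNReal.ofReal (‖b h m‖ * ω ξ) * ‖fourier hs f (ξ + scale m h)‖ₑ := by
          rw [ENNReal.ofReal_mul (norm_nonneg _), ofReal_norm]; ring
      _ ≤ ENNReal.ofReal (Cb * Cω * (1 + Cf * ω 0) * Real.exp (-(K * μ)) * ω (ξ + scale m h)) *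
          ‖fourier hs f (ξ + scale m h)‖ₑ := by gcongr
      _ = ENNReal.ofReal (Cb * Cω * (1 + Cf * ω 0) * Real.exp (-(K * μ))) *
          (‖fourier hs f (ξ + scale m h)‖ₑ * ENNReal.ofReal (ω (ξ + scale m h))) := by
          rw [ENNReal.ofReal_mul (by positivity)]; ring
      _ ≤ _ := by
          gcongr
          exact ofReal_le_ballSup ω _
  · have hξρ : ‖ξ‖ ≤ ρ * intNorm m := by
      rw [hρ, div_mul_eq_mul_div, le_div_iff₀ hc, mul_comm]
      exact (not_le.1 hgood).le.trans (norm_scale_le hh₀ m hh)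
    have hmem : (0 : Rd d) ∈ Metric.closedBall ξ (ρ * intNorm m) := by
      simpa [dist_eq_norm] using hξρ
    refine le_trans ?_ (mul_le_mul_right (le_add_right le_rfl) _)
    rw [Set.indicator_of_mem hmem, Pi.one_apply, mul_one, ← ofReal_norm,
      ← ENNReal.ofReal_mul (norm_nonneg _), norm_mul]
    refine ENNReal.ofReal_le_ofReal ?_
    have h2 : ‖ξ‖ ^ (1 / s) ≤ ρ ^ (1 / s) * μ :=
      (Real.rpow_le_rpow (norm_nonneg _) hξρ (by positivity)).trans
        (mul_intNorm_rpow_le hs (by positivity) m)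
    have h3 : ‖ξ + scale m h‖ ^ (1 / s) ≤ ρ ^ (1 / s) * μ + (2 * h₀) ^ (1 / s) * μ :=
      (Real.rpow_le_rpow (norm_nonneg _) (norm_add_le _ _) (by positivity)).trans
        ((rpow_add_le hs (norm_nonneg _) (norm_nonneg _)).trans (add_le_add h2 hscale))
    have h4 := hωle ξ 0
    rw [add_zero] at h4
    have h5 := hω0 0
    have h6 : -((K + a₁ + a₂) * μ) + s * d * ‖ξ + scale m h‖ ^ (1 / s) + k * ‖ξ‖ ^ (1 / s) ≤
        -(K * μ) := by
      have h7 : s * d * ‖ξ + scale m h‖ ^ (1 / s) ≤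
          s * d * (ρ ^ (1 / s) * μ + (2 * h₀) ^ (1 / s) * μ) := by gcongr
      have h8 : k * ‖ξ‖ ^ (1 / s) ≤ k * (ρ ^ (1 / s) * μ) := by gcongr
      have h9 : 0 ≤ a₁ * μ := by positivity
      rw [ha₂]
      linarith
    calc ‖b h m‖ * ‖fourier hs f (ξ + scale m h)‖ * ω ξ
        ≤ (Cb * Real.exp (-((K + a₁ + a₂) * μ))) *
          (Cf * Real.exp (s * d * ‖ξ + scale m h‖ ^ (1 / s))) *
          (Cω * Real.exp (k * ‖ξ‖ ^ (1 / s)) * ω 0) := by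
            have := hfle (ξ + scale m h)
            rw [growth] at this
            gcongr
            exact hω0 ξ
      _ = Cb * Cω * (Cf * ω 0) * Real.exp (-((K + a₁ + a₂) * μ) +
          s * d * ‖ξ + scale m h‖ ^ (1 / s) + k * ‖ξ‖ ^ (1 / s)) := by
            rw [Real.exp_add, Real.exp_add]; ring
      _ ≤ Cb * Cω * (1 + Cf * ω 0) * Real.exp (-(K * μ)) := by
            gcongr
            linarith

/-! ### Summation over the lattice -/

theorem expWeight_add {d : ℕ} (s K L : ℝ) (m : Fin d → ℤ) :
    expWeight s (K + L) m = expWeight s K m * expWeight s L m := by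
  by_cases hm : m ∈ {m : Fin d → ℤ | ∀ i, m i ≠ 0}
  · simp only [expWeight, Set.indicator_of_mem hm]
    rw [← ENNReal.ofReal_mul (Real.exp_pos _).le, ← Real.exp_add]
    congr 2
    ring
  · simp only [expWeight, Set.indicator_of_notMem hm, mul_zero]

theorem expWeight_le_one {d : ℕ} {s K : ℝ} (hK : 0 ≤ K) (m : Fin d → ℤ) : expWeight s K m ≤ 1 := by
  refine Set.indicator_apply_le' (fun _ => ?_) (fun _ => zero_le)
  rw [← ENNReal.ofReal_one]
  refine ENNReal.ofReal_le_ofReal (Real.exp_le_one_iff.2 ?_)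
  have := powWeight_nonneg s m
  exact neg_nonpos.2 (by positivity)

theorem tsum_expWeight_lt_top {d : ℕ} {s : ℝ} (hs : 1 < s) :
    ∑' m : Fin d → ℤ, expWeight s s m < ∞ := by
  refine lt_of_le_of_lt (ENNReal.tsum_le_tsum fun m => ?_)
    (summable_exp_neg_powWeight (d := d) hs).tsum_ofReal_lt_top
  exact Set.indicator_le_self' (fun _ _ => zero_le) m

/-- A series with summable weights is dominated in `p`-th power by the series of `p`-th powers. -/
theorem tsum_mul_rpow_le {ι : Type*} (w Z : ι → ℝ≥0∞) {p : ℝ} (hp : 0 < p) :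
    (∑' i, w i * Z i) ^ p ≤ (∑' i, w i) ^ p * ∑' i, Z i ^ p := by
  -- Each entry is at most the ℓ^p expression, which can then be pulled out of the weighted sum.
  have h1 : ∀ i, Z i ≤ (∑' i, Z i ^ p) ^ (1 / p) := by
    intro i
    calc Z i = (Z i ^ p) ^ (1 / p) := by
          rw [← ENNReal.rpow_mul, mul_one_div_cancel hp.ne', ENNReal.rpow_one]
      _ ≤ _ := ENNReal.rpow_le_rpow (ENNReal.le_tsum i) (by positivity)
  calc (∑' i, w i * Z i) ^ p ≤ ((∑' i, w i) * (∑' i, Z i ^ p) ^ (1 / p)) ^ p := by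
        refine ENNReal.rpow_le_rpow ?_ hp.le
        rw [← ENNReal.tsum_mul_right]
        exact ENNReal.tsum_le_tsum fun i => by gcongr; exact h1 i
    _ = _ := by
        rw [ENNReal.mul_rpow_of_nonneg _ _ hp.le, ← ENNReal.rpow_mul,
          one_div_mul_cancel hp.ne', ENNReal.rpow_one]

/-- The part `L` of the rate absorbs the lattice count; the part `s` is kept for summation over m.
-/
theorem expWeight_mul_ofReal_le {d : ℕ} {s L r : ℝ} (hs : 1 < s) (hr : 0 ≤ r) {C κ : ℝ}
    (hC : 0 ≤ C) (hκ : 0 ≤ κ) (hL : (κ * r) ^ (1 / s) ≤ L) (m : Fin d → ℤ) :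
    expWeight s (s + L) m *
      ENNReal.ofReal (C * Real.exp ((κ * (r * intNorm m)) ^ (1 / s))) ≤
      ENNReal.ofReal C * expWeight s s m := by
  rw [expWeight_add, mul_assoc, mul_comm (ENNReal.ofReal C)]
  gcongr
  by_cases hm : m ∈ {m : Fin d → ℤ | ∀ i, m i ≠ 0}
  · rw [expWeight, Set.indicator_of_mem hm, ← ENNReal.ofReal_mul (Real.exp_pos _).le]
    refine ENNReal.ofReal_le_ofReal ?_
    rw [mul_left_comm, ← Real.exp_add]
    refine mul_le_of_le_one_right hC (Real.exp_le_one_iff.2 ?_)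
    have h1 := mul_intNorm_rpow_le hs (mul_nonneg hκ hr) m
    rw [← mul_assoc]
    have := powWeight_nonneg s m
    nlinarith
  · rw [expWeight, Set.indicator_of_notMem hm, zero_mul]
    exact zero_le

theorem exists_localized_le {d : ℕ} {s : ℝ} (hs : 1 < s) (f : CompactUltradistribution d s)
    {ω : Rd d → ℝ} (hω : IsRoumieuWeight s ω) (Γ : Set (Rd d)) :
    ∃ C : ℝ≥0∞, C ≠ ∞ ∧ ∀ y, localized hs f ω Γ y ≤
      Γ.indicator (fun y => C * ‖fourier hs f y * (ω y : ℂ)‖ₑ) y := by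
  obtain ⟨C, hC, h⟩ := hω.exists_ballSup_le hs
  refine ⟨ENNReal.ofReal C, ENNReal.ofReal_ne_top, fun y => ?_⟩
  refine Set.indicator_le_indicator ?_
  rw [enorm_mul_ofReal (hω.1 y), mul_left_comm]
  gcongr
  exact h y

theorem ae_add_scale_of_ae {d : ℕ} {m : Fin d → ℤ} (hm : ∀ i, m i ≠ 0) (ξ : Rd d) {P : Rd d → Prop}
    (hP : ∀ᵐ y : Rd d, P y) : ∀ᵐ h : Rd d, P (ξ + scale m h) := by
  have hq : Measure.QuasiMeasurePreserving (fun h : Rd d => scale m h) volume volume :=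
    ⟨(continuous_scale m).measurable, Measure.absolutelyContinuous_of_le (map_scale_volume_le hm)⟩
  exact ((measurePreserving_add_left volume ξ).quasiMeasurePreserving.comp hq).ae hP

/-- For fixed ξ, almost every h satisfies the essential bound at ξ + `scale m h` for all of the
countably many admissible m; the box has positive measure, so it contains such an h. -/
theorem discSeminorm_top_lt {d : ℕ} {s : ℝ} (hs : 1 < s) {ω : Rd d → ℝ} (hω : IsRoumieuWeight s ω)
    (f : CompactUltradistribution d s) {Γ Γ₀ : Set (Rd d)} (hΓ : IsOpenCone Γ)
    (hΓ₀ : IsOpenCone Γ₀) (hsub : closure Γ₀ \ {0} ⊆ Γ) (Λ : Set (Rd d))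
    (hfin : contSeminorm hs ∞ ω Γ f < ∞) : discSeminorm hs ∞ ω (Γ₀ ∩ Λ) f < ∞ := by
  obtain ⟨h₀, ρ, hh₀, hρ, hK⟩ := exists_enorm_fourier_mul_le hs f hω hΓ hΓ₀ hsub
  obtain ⟨D, hD, hle⟩ := hK s (by linarith)
  obtain ⟨C, hC, hloc⟩ := exists_localized_le hs f hω Γ
  set M := contSeminorm hs ∞ ω Γ f with hM
  have hae : ∀ᵐ y : Rd d, localized hs f ω Γ y ≤ C * M := by
    have h1 : ∀ᵐ y ∂(volume.restrict Γ), ‖fourier hs f y * (ω y : ℂ)‖ₑ ≤ M := by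
      rw [hM, contSeminorm, eLpNorm_exponent_top]
      exact enorm_ae_le_eLpNormEssSup _ _
    filter_upwards [(ae_restrict_iff' hΓ.1.measurableSet).1 h1] with y hy
    refine (hloc y).trans (Set.indicator_apply_le' (fun hyΓ => ?_) fun _ => zero_le)
    gcongr
    exact hy hyΓ
  rw [discSeminorm, if_pos rfl]
  refine lt_of_le_of_lt (iSup₂_le fun ξ hξ => ?_)
    (b := ENNReal.ofReal D * ((∑' m : Fin d → ℤ, expWeight s s m) * (1 + C * M)))
    (ENNReal.mul_lt_top ENNReal.ofReal_lt_top (ENNReal.mul_lt_top (tsum_expWeight_lt_top hs)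
      (ENNReal.add_lt_top.2 ⟨ENNReal.one_lt_top, ENNReal.mul_lt_top hC.lt_top hfin⟩)))
  have hall : ∀ᵐ h : Rd d, ∀ m : Fin d → ℤ, (∀ i, m i ≠ 0) →
      localized hs f ω Γ (ξ + scale m h) ≤ C * M := by
    refine ae_all_iff.2 fun m => ?_
    by_cases hm : ∀ i, m i ≠ 0
    · filter_upwards [ae_add_scale_of_ae hm ξ hae] with h hh _ using hh
    · exact Eventually.of_forall fun h hm' => absurd hm' hm
  obtain ⟨h, hbox, hh⟩ : ∃ h ∈ box d h₀, ∀ m : Fin d → ℤ, (∀ i, m i ≠ 0) →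
      localized hs f ω Γ (ξ + scale m h) ≤ C * M := by
    by_contra! hcon
    refine (volume_box_pos d hh₀).ne' (measure_mono_null (fun h hb => ?_) (ae_iff.1 hall))
    obtain ⟨m, hm, hlt⟩ := hcon h hb
    exact fun hall' => (hall' m hm).not_gt hlt
  refine (hle ξ hξ.1 h hbox).trans ?_
  gcongr
  rw [← ENNReal.tsum_mul_right]
  refine ENNReal.tsum_le_tsum fun m => ?_
  by_cases hm : ∀ i, m i ≠ 0
  · gcongr
    · exact Set.indicator_le_self' (fun _ _ => zero_le) _
    · exact hh m hm
  · simp [expWeight_eq_zero s s hm]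

theorem discSeminorm_lt_of_ne_top {d : ℕ} {s : ℝ} (hs : 1 < s) {q : ℝ≥0∞} (hq : 1 ≤ q)
    (hq' : q ≠ ∞) {ω : Rd d → ℝ} (hω : IsRoumieuWeight s ω)
    (f : CompactUltradistribution d s) {Γ Γ₀ : Set (Rd d)} (hΓ : IsOpenCone Γ)
    (hΓ₀ : IsOpenCone Γ₀) (hsub : closure Γ₀ \ {0} ⊆ Γ) {Λ : Set (Rd d)} (hΛ : IsLattice Λ)
    (hfin : contSeminorm hs q ω Γ f < ∞) : discSeminorm hs q ω (Γ₀ ∩ Λ) f < ∞ := by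
  set p := q.toReal with hp
  have hp1 : 1 ≤ p := by
    rw [hp, ← ENNReal.toReal_one]
    exact ENNReal.toReal_mono hq' hq
  have hp0 : 0 < p := by linarith
  have hs0 : 0 < s := by linarith
  obtain ⟨h₀, ρ, hh₀, hρ, hK⟩ := exists_enorm_fourier_mul_le hs f hω hΓ hΓ₀ hsub
  obtain ⟨C, hC, hloc⟩ := exists_localized_le hs f hω Γ
  obtain ⟨κ, N, hκ, hN, hcount⟩ := hΛ.exists_sum_indicator_le hs
  set L := (κ * (2 * h₀)) ^ (1 / s) + (κ * ρ) ^ (1 / s) with hL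
  have hL1 : (κ * (2 * h₀)) ^ (1 / s) ≤ L := le_add_of_nonneg_right (by positivity)
  have hL2 : (κ * ρ) ^ (1 / s) ≤ L := le_add_of_nonneg_left (by positivity)
  -- One `s` is spent on taking p-th powers of the sum over m, the other on the final sum over m,
  -- and `L` on the two lattice counts.
  obtain ⟨D, hD, hle⟩ := hK (s + (s + L)) (by positivity)
  set F := localized hs f ω Γ with hF
  have hFm : Measurable fun y => F y ^ p := (measurable_localized hs f ω hΓ.1).pow_const p
  have hFfin : ∫⁻ y, F y ^ p < ∞ := by
    have h1 : ∫⁻ y in Γ, ‖fourier hs f y * (ω y : ℂ)‖ₑ ^ p < ∞ :=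
      lintegral_rpow_enorm_lt_top_of_eLpNorm_lt_top (by positivity) hq' hfin
    calc ∫⁻ y, F y ^ p ≤ ∫⁻ y, Γ.indicator (fun y => C ^ p * ‖fourier hs f y * (ω y : ℂ)‖ₑ ^ p) y := by
          refine lintegral_mono fun y => ?_
          refine (ENNReal.rpow_le_rpow (hloc y) hp0.le).trans_eq ?_
          by_cases hy : y ∈ Γ
          · rw [Set.indicator_of_mem hy, Set.indicator_of_mem hy,
              ENNReal.mul_rpow_of_nonneg _ _ hp0.le]
          · rw [Set.indicator_of_notMem hy, Set.indicator_of_notMem hy,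
              ENNReal.zero_rpow_of_pos hp0]
      _ = C ^ p * ∫⁻ y in Γ, ‖fourier hs f y * (ω y : ℂ)‖ₑ ^ p := by
          rw [lintegral_indicator hΓ.1.measurableSet,
            lintegral_const_mul' _ _ (ENNReal.rpow_ne_top_of_nonneg hp0.le hC)]
      _ < ∞ := ENNReal.mul_lt_top (ENNReal.rpow_lt_top_of_nonneg hp0.le hC) h1
  set S := ∑' m : Fin d → ℤ, expWeight s s m with hS
  have hSfin : S < ∞ := tsum_expWeight_lt_top hs
  set V := volume (box d h₀) with hV
  have hV0 : V ≠ 0 := (volume_box_pos d hh₀).ne'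
  have hVfin : V < ∞ := (isCompact_box d h₀).measure_lt_top
  set B : Rd d → (Fin d → ℤ) → ℝ≥0∞ := fun ξ m =>
    (Metric.closedBall ξ (ρ * intNorm m)).indicator 1 0 with hB
  set A : ℝ≥0∞ := ENNReal.ofReal D ^ p * (S ^ p * 2 ^ (p - 1)) with hA
  have hAfin : A < ∞ := by
    refine ENNReal.mul_lt_top (ENNReal.rpow_lt_top_of_nonneg hp0.le ENNReal.ofReal_ne_top)
      (ENNReal.mul_lt_top (ENNReal.rpow_lt_top_of_nonneg hp0.le hSfin.ne)
        (ENNReal.rpow_lt_top_of_nonneg (by linarith) (by simp)))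
  -- In p-th powers the remaining weight only decreases, being at most 1, and the indicator is
  -- unchanged; convexity gives 2^(p-1).
  have hpow : ∀ ξ ∈ Γ₀, ∀ h ∈ box d h₀, ‖fourier hs f ξ * (ω ξ : ℂ)‖ₑ ^ p ≤
      A * ∑' m, expWeight s (s + L) m * (B ξ m + F (ξ + scale m h) ^ p) := by
    intro ξ hξ h hh
    refine (ENNReal.rpow_le_rpow (hle ξ hξ h hh) hp0.le).trans ?_
    rw [ENNReal.mul_rpow_of_nonneg _ _ hp0.le, hA, mul_assoc]
    gcongr
    simp_rw [expWeight_add s s (s + L), mul_assoc]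
    refine (tsum_mul_rpow_le _ _ hp0).trans ?_
    rw [← hS]
    gcongr
    rw [← ENNReal.tsum_mul_left]
    refine ENNReal.tsum_le_tsum fun m => ?_
    rw [ENNReal.mul_rpow_of_nonneg _ _ hp0.le, mul_left_comm]
    have hw : expWeight s (s + L) m ^ p ≤ expWeight s (s + L) m := by
      have := ENNReal.rpow_le_rpow_of_exponent_ge (expWeight_le_one (s := s) (K := s + L)
        (by positivity) m) hp1
      rwa [ENNReal.rpow_one] at this
    have hBp : B ξ m ^ p = B ξ m := by
      simp only [hB]
      by_cases h0 : (0 : Rd d) ∈ Metric.closedBall ξ (ρ * intNorm m)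
      · rw [Set.indicator_of_mem h0, Pi.one_apply, ENNReal.one_rpow]
      · rw [Set.indicator_of_notMem h0, ENNReal.zero_rpow_of_pos hp0]
    refine mul_le_mul' hw ?_
    refine (ENNReal.rpow_add_le_mul_rpow_add_rpow _ _ hp1).trans_eq ?_
    change 2 ^ (p - 1) * (B ξ m ^ p + _) = _
    rw [hBp]
  -- The left side of `hpow` does not depend on h, so integration over the box multiplies it by `V`.
  have hint : ∀ ξ ∈ Γ₀, V * ‖fourier hs f ξ * (ω ξ : ℂ)‖ₑ ^ p ≤
      A * ∑' m, expWeight s (s + L) m *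
        (V * B ξ m + ∫⁻ h in box d h₀, F (ξ + scale m h) ^ p) := by
    intro ξ hξ
    have hmeas : ∀ m : Fin d → ℤ, Measurable fun h : Rd d => F (ξ + scale m h) ^ p := fun m =>
      hFm.comp ((continuous_const.add (continuous_scale m)).measurable)
    calc V * ‖fourier hs f ξ * (ω ξ : ℂ)‖ₑ ^ p
        = ∫⁻ _ in box d h₀, ‖fourier hs f ξ * (ω ξ : ℂ)‖ₑ ^ p := by
          rw [setLIntegral_const, mul_comm]
      _ ≤ ∫⁻ h in box d h₀, A * ∑' m, expWeight s (s + L) m * (B ξ m + F (ξ + scale m h) ^ p) :=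
          setLIntegral_mono' (isCompact_box d h₀).isClosed.measurableSet (hpow ξ hξ)
      _ = A * ∑' m, ∫⁻ h in box d h₀, expWeight s (s + L) m * (B ξ m + F (ξ + scale m h) ^ p) := by
          rw [lintegral_const_mul' _ _ hAfin.ne, lintegral_tsum]
          exact fun m => (((hmeas m).const_add _).const_mul _).aemeasurable
      _ = _ := by
          congr 1
          refine tsum_congr fun m => ?_
          rw [lintegral_const_mul _ ((hmeas m).const_add _), lintegral_add_left measurable_const,
            setLIntegral_const, mul_comm V]
  -- For fixed m, sum over ξ first: the lattice count at 0 bounds the indicators, the count at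
  -- arbitrary y bounds the integrals.
  have hsum : V * ∑' ξ : ↥(Γ₀ ∩ Λ), ‖fourier hs f ξ * (ω ξ : ℂ)‖ₑ ^ p ≤
      A * (ENNReal.ofReal N * S * (V + ∫⁻ y, F y ^ p)) := by
    calc V * ∑' ξ : ↥(Γ₀ ∩ Λ), ‖fourier hs f ξ * (ω ξ : ℂ)‖ₑ ^ p
        ≤ ∑' ξ : ↥(Γ₀ ∩ Λ), A * ∑' m, expWeight s (s + L) m *
            (V * B ξ m + ∫⁻ h in box d h₀, F (ξ + scale m h) ^ p) := by
          rw [← ENNReal.tsum_mul_left]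
          exact ENNReal.tsum_le_tsum fun ξ => hint ξ ξ.2.1
      _ ≤ ∑' ξ : Λ, A * ∑' m, expWeight s (s + L) m *
            (V * B ξ m + ∫⁻ h in box d h₀, F (ξ + scale m h) ^ p) :=
          ENNReal.tsum_mono_subtype (fun ξ : Rd d => A * ∑' m, expWeight s (s + L) m *
            (V * B ξ m + ∫⁻ h in box d h₀, F (ξ + scale m h) ^ p)) Set.inter_subset_right
      _ = A * ∑' m, expWeight s (s + L) m * (V * ∑' ξ : Λ, B ξ m +
            ∑' ξ : Λ, ∫⁻ h in box d h₀, F (ξ + scale m h) ^ p) := by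
          rw [ENNReal.tsum_mul_left, ENNReal.tsum_comm]
          congr 1
          refine tsum_congr fun m => ?_
          rw [ENNReal.tsum_mul_left, ENNReal.tsum_add, ENNReal.tsum_mul_left]
      _ ≤ A * ∑' m, ENNReal.ofReal N * expWeight s s m * (V + ∫⁻ y, F y ^ p) := by
          refine mul_le_mul_right (ENNReal.tsum_le_tsum fun m => ?_) A
          by_cases hm : ∀ i, m i ≠ 0
          swap
          · rw [expWeight_eq_zero s _ hm, zero_mul]
            exact zero_le
          have h1 : ∑' ξ : Λ, B ξ m ≤ _ :=
            hcount 0 (ρ * intNorm m) (mul_nonneg hρ.le (intNorm_nonneg m))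
          have h2 := tsum_lintegral_box_le hh₀ hm hFm hΛ.countable
            fun y => hcount y (2 * h₀ * intNorm m)
              (mul_nonneg (by positivity) (intNorm_nonneg m))
          have h3 := expWeight_mul_ofReal_le hs hρ.le hN.le hκ.le hL2 m
          have h4 := expWeight_mul_ofReal_le hs (r := 2 * h₀) (by positivity) hN.le hκ.le hL1 m
          rw [mul_add, mul_add]
          refine add_le_add ?_ ?_
          · refine (mul_le_mul' le_rfl (mul_le_mul' le_rfl h1)).trans ?_
            rw [mul_comm V, ← mul_assoc]
            exact mul_le_mul' h3 le_rfl
          · refine (mul_le_mul' le_rfl h2).trans ?_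
            rw [← mul_assoc]
            exact mul_le_mul' h4 le_rfl
      _ = _ := by rw [ENNReal.tsum_mul_right, ENNReal.tsum_mul_left]
  have htop : ∑' ξ : ↥(Γ₀ ∩ Λ), ‖fourier hs f ξ * (ω ξ : ℂ)‖ₑ ^ p < ∞ := by
    have h1 : A * (ENNReal.ofReal N * S * (V + ∫⁻ y, F y ^ p)) < ∞ :=
      ENNReal.mul_lt_top hAfin (ENNReal.mul_lt_top
        (ENNReal.mul_lt_top ENNReal.ofReal_lt_top hSfin) (ENNReal.add_lt_top.2 ⟨hVfin, hFfin⟩))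
    exact ENNReal.lt_top_of_mul_ne_top_right (hsum.trans_lt h1).ne hV0
  rw [discSeminorm, if_neg hq']
  exact ENNReal.rpow_lt_top_of_nonneg (by positivity) htop.ne

end Ultra

theorem lemma4p1 (d : ℕ) (s : ℝ) (hs : 1 < s) (q : ℝ≥0∞) (hq : 1 ≤ q)
    (ω : Ultra.Rd d → ℝ) (hω : Ultra.IsRoumieuWeight s ω)
    (f : Ultra.CompactUltradistribution d s)
    (Γ Γ₀ : Set (Ultra.Rd d)) (hΓ : Ultra.IsOpenCone Γ) (hΓ₀ : Ultra.IsOpenCone Γ₀)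
    (hsub : closure Γ₀ \ {0} ⊆ Γ)
    (Λ : Set (Ultra.Rd d)) (hΛ : Ultra.IsLattice Λ)
    (hfin : Ultra.contSeminorm hs q ω Γ f < ∞) :
    Ultra.discSeminorm hs q ω (Γ₀ ∩ Λ) f < ∞ := by
  rcases eq_or_ne q ∞ with rfl | hq'
  · exact Ultra.discSeminorm_top_lt hs hω f hΓ hΓ₀ hsub Λ hfin
  · exact Ultra.discSeminorm_lt_of_ne_top hs hq hq' hω f hΓ hΓ₀ hsub hΛ hfin
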